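/- Let $V$ be a complex vector space with a basis $(v_i)_{i\in I}$, graded by assigning to each $v_i$ a positive integer degree $\deg(v_i)$. For a word $\alpha=(\alpha_1,\dots,\alpha_\ell)$ in $I$ write $v_\alpha=v_{\alpha_1}\otimes\cdots\otimes v_{\alpha_\ell}$ and $\deg(v_\alpha)=\sum_k\deg(v_{\alpha_k})$; call $v_\alpha$ odd (even) if every $\deg(v_{\alpha_k})$ is odd (even). Let $\mathrm{O}(V)$ and $\mathrm{E}(V)$ be the spans of the $v_i$ of odd and of even degree. Consider three graded connected Hopf algebras, all graded by $\deg$: * $\mathrm{S}(V)=\bigoplus_n V^{\otimes n}$, the shuffle algebra (shuffle product of words, deconcatenation coproduct); * $\mathrm{T}(V)$, the tensor algebra (concatenation product, each $v_i$ primitive); * $\mathrm{Sym}(V)$, the symmetric algebra (the quotient of $\mathrm{T}(V)$ by the commutators), with $\overline{v_\alpha}$ the class of $v_\alpha$. Let $M_\alpha=\sum_{j_1<\cdots<j_\ell}x_{j_1}^{\alpha_1}\cdots x_{j_\ell}^{\alpha_\ell}$ be the monomial quasisymmetric functions and $\zeta(f)=f(1,0,0,\dots)$. For a composition $\alpha$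 put $S_\alpha=\sum_\beta c_\alpha^\beta M_\beta$, where $\beta$ runs over the compositions obtained by cutting $\alpha$ into consecutive nonempty blocks, none of which contains an odd part immediately followed by an even part, and summing each block, and where $c_\alpha^\beta$ is the product over the blocks of $\frac{1}{O!\,E!}$, with $O$ and $E$ the numbers of odd and of even parts in the block. The canonical characters are $\zeta_{\mathrm{S}(V)}(v_\alpha)=\zeta\bigl(S_{(\deg v_{\alpha_1},\dots,\deg v_{\alpha_\ell})}\bigr)$, extended linearly, and, extended linearly and multiplicatively, $\zeta_{\mathrm{T}(V)}(v_i)=\zeta_{\mathrm{Sym}(V)}(\overline{v_i})=\zeta\bigl(\tfrac{1}{\deg v_i}M_{(\deg v_i)}\bigr)=\tfrac{1}{\deg v_i}$. For a graded connected Hopf algebra $\mathsf H$ with antipode $\mathcal S$ and a character $\zeta_{\mathsf H}:\mathsf H\to\mathbb C$, let $\zeta_{\mathsf H}^{-1}=\zeta_{\mathsf H}\circ\mathcal S$ and, for a functional $\varphi$, let $\overline{\varphi}=(-1)^n\varphi$ on $\mathsf H_n$. Let $\mathsf S_-(\mathsf H,\zeta_{\mathsf H})$ and $\mathsf S_+(\mathsf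 H,\zeta_{\mathsf H})$ be the largest subcoalgebras of $\mathsf H$ contained in $\ker(\overline{\zeta_{\mathsf H}^{-1}}-\zeta_{\mathsf H})$ and in $\ker(\overline{\zeta_{\mathsf H}}-\zeta_{\mathsf H})$, respectively. Then, with $\mathrm{S}(\mathrm{O}(V))$, $\mathrm{T}(\mathrm{O}(V))$, $\mathrm{Sym}(\mathrm{O}(V))$ the spans of the odd $v_\alpha$ in $\mathrm S(V)$ and in $\mathrm T(V)$ and of their classes in $\mathrm{Sym}(V)$, and likewise for $\mathrm{E}(V)$ with the even $v_\alpha$: 1. $\mathrm{S}(\mathrm{O}(V))\subseteq\mathsf S_-(\mathrm S(V),\zeta_{\mathrm S(V)})$ and $\mathrm{S}(\mathrm{E}(V))\subseteq\mathsf S_+(\mathrm S(V),\zeta_{\mathrm S(V)})$; 2. $\mathrm{T}(\mathrm{O}(V))\subseteq\mathsf S_-(\mathrm T(V),\zeta_{\mathrm T(V)})$ and $\mathrm{T}(\mathrm{E}(V))\subseteq\mathsf S_+(\mathrm T(V),\zeta_{\mathrm T(V)})$; 3. $\mathrm{Sym}(\mathrm{O}(V))\subseteq\mathsf S_-(\mathrm{Sym}(V),\zeta_{\mathrm{Sym}(V)})$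 and $\mathrm{Sym}(\mathrm{E}(V))\subseteq\mathsf S_+(\mathrm{Sym}(V),\zeta_{\mathrm{Sym}(V)})$. -/

import Mathlib

open scoped TensorProduct

noncomputable section

/-- The underlying vector space of the shuffle algebra on an alphabet `I`: formal complex linear
combinations of words in the letters `I`. -/
def ShuffleAlgebra (I : Type*) : Type _ := List I →₀ ℂ

namespace ShuffleAlgebra

variable {I : Type*}

instance : AddCommGroup (ShuffleAlgebra I) := inferInstanceAs (AddCommGroup (List I →₀ ℂ))

instance : Module ℂ (ShuffleAlgebra I) := inferInstanceAs (Module ℂ (List I →₀ ℂ))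

/-- The basis of words. -/
def wordBasis (I : Type*) : Module.Basis (List I) ℂ (ShuffleAlgebra I) :=
  Module.Basis.ofRepr (LinearEquiv.refl ℂ (List I →₀ ℂ))

/-- The basis element given by a word. -/
def word (w : List I) : ShuffleAlgebra I := wordBasis I w

/-- Linear extension of a map defined on words. -/
def extend {M : Type*} [AddCommGroup M] [Module ℂ M] (f : List I → M) :
    ShuffleAlgebra I →ₗ[ℂ] M :=
  (wordBasis I).constr ℂ f

@[simp]
theorem extend_word {M : Type*} [AddCommGroup M] [Module ℂ M] (f : List I → M) (w : List I) :
    extend f (word w) = f w :=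
  (wordBasis I).constr_basis ℂ f w

theorem hom_ext {M : Type*} [AddCommGroup M] [Module ℂ M] {f g : ShuffleAlgebra I →ₗ[ℂ] M}
    (h : ∀ w, f (word w) = g (word w)) : f = g :=
  (wordBasis I).ext h

/-- The multiset of all shuffles of two words. -/
def shuffles : List I → List I → Multiset (List I)
  | [], v => {v}
  | a :: u, [] => {a :: u}
  | a :: u, b :: v => (shuffles u (b :: v)).map (a :: ·) + (shuffles (a :: u) v).map (b :: ·)
termination_by u v => u.length + v.length

@[simp] theorem shuffles_nil_left (v : List I) : shuffles [] v = {v} := by rw [shuffles]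

@[simp] theorem shuffles_nil_right (u : List I) : shuffles u [] = {u} := by
  cases u <;> rw [shuffles]

theorem shuffles_cons_cons (a b : I) (u v : List I) :
    shuffles (a :: u) (b :: v) =
      (shuffles u (b :: v)).map (a :: ·) + (shuffles (a :: u) v).map (b :: ·) := by
  rw [shuffles]

/-- The shuffle product as a bilinear map. -/
def shuffleMul : ShuffleAlgebra I →ₗ[ℂ] ShuffleAlgebra I →ₗ[ℂ] ShuffleAlgebra I :=
  extend fun u => extend fun v => ((shuffles u v).map word).sum

instance : Mul (ShuffleAlgebra I) := ⟨fun x y => shuffleMul x y⟩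

instance : One (ShuffleAlgebra I) := ⟨word []⟩

theorem mul_eq (x y : ShuffleAlgebra I) : x * y = shuffleMul x y := rfl

theorem one_eq : (1 : ShuffleAlgebra I) = word [] := rfl

theorem word_mul_word (u v : List I) : word u * word v = ((shuffles u v).map word).sum := by
  simp [mul_eq, shuffleMul]

/-- Prepending a letter. -/
def cons (a : I) : ShuffleAlgebra I →ₗ[ℂ] ShuffleAlgebra I := extend fun w => word (a :: w)

/-- Appending a letter. -/
def snoc (a : I) : ShuffleAlgebra I →ₗ[ℂ] ShuffleAlgebra I := extend fun w => word (w ++ [a])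

@[simp] theorem cons_word (a : I) (w : List I) : cons a (word w) = word (a :: w) := by simp [cons]

@[simp] theorem snoc_word (a : I) (w : List I) : snoc a (word w) = word (w ++ [a]) := by
  simp [snoc]

theorem word_cons_mul_word_cons (a b : I) (u v : List I) :
    word (a :: u) * word (b :: v) =
      cons a (word u * word (b :: v)) + cons b (word (a :: u) * word v) := by
  simp only [word_mul_word, shuffles_cons_cons, Multiset.map_add, Multiset.sum_add,
    map_multiset_sum, Multiset.map_map, Function.comp_def, cons_word]

theorem shuffles_comm (u v : List I) : shuffles u v = shuffles v u := by
  induction u generalizing v with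
  | nil => simp
  | cons a u ihu =>
    induction v with
    | nil => simp
    | cons b v ihv => rw [shuffles_cons_cons, shuffles_cons_cons, ihu, ihv, add_comm]

theorem one_mul' (x : ShuffleAlgebra I) : 1 * x = x := by
  change shuffleMul 1 x = LinearMap.id (R := ℂ) x
  refine LinearMap.congr_fun (hom_ext fun w => ?_) x
  rw [← mul_eq, one_eq, word_mul_word]; simp

theorem mul_comm' (x y : ShuffleAlgebra I) : x * y = y * x := by
  change shuffleMul x y = shuffleMul.flip x y
  refine LinearMap.congr_fun₂ (hom_ext fun u => hom_ext fun v => ?_) x y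
  rw [LinearMap.flip_apply, ← mul_eq, ← mul_eq, word_mul_word, word_mul_word, shuffles_comm]

instance : NonUnitalNonAssocCommRing (ShuffleAlgebra I) where
  left_distrib x y z := map_add (shuffleMul x) y z
  right_distrib x y z := LinearMap.map_add₂ shuffleMul x y z
  zero_mul x := LinearMap.map_zero₂ shuffleMul x
  mul_zero x := map_zero (shuffleMul x)
  mul_comm := mul_comm'

theorem smul_mul' (r : ℂ) (x y : ShuffleAlgebra I) : r • x * y = r • (x * y) :=
  LinearMap.map_smul₂ shuffleMul r x y

theorem cons_mul_cons (a b : I) (x y : ShuffleAlgebra I) :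
    cons a x * cons b y = cons a (x * cons b y) + cons b (cons a x * y) := by
  have h : (shuffleMul.compl₁₂ (cons a) (cons b)) =
      (shuffleMul.compl₁₂ LinearMap.id (cons b)).compr₂ (cons a) +
        (shuffleMul.compl₁₂ (cons a) LinearMap.id).compr₂ (cons b) :=
    hom_ext fun u => hom_ext fun v => by
      simpa [mul_eq] using word_cons_mul_word_cons a b u v
  exact LinearMap.congr_fun₂ h x y

theorem mul_assoc_word (u v w : List I) :
    word u * word v * word w = word u * (word v * word w) := by
  have h1 : ∀ x : ShuffleAlgebra I, word [] * x = x := one_mul'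
  have h2 : ∀ x : ShuffleAlgebra I, x * word [] = x := fun x => by rw [mul_comm, h1]
  induction u generalizing v w with
  | nil => simp only [h1]
  | cons a u ihu =>
    induction v generalizing w with
    | nil => simp only [h1, h2]
    | cons b v ihv =>
      induction w with
      | nil => simp only [h2]
      | cons c w ihw =>
        have e1 := ihu (b :: v) (c :: w)
        have e2 := ihv (c :: w)
        simp only [← cons_word] at e1 e2 ihw ⊢
        generalize word u = u at *
        generalize word v = v at *
        generalize word w = w at *
        have l : cons a u * cons b v * cons c w =
            cons a (u * (cons b v * cons c w)) + cons b (cons a u * (v * cons c w)) +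
              cons c (cons a u * (cons b v * w)) := by
          rw [← e1, ← e2, ← ihw, cons_mul_cons a b, add_mul, cons_mul_cons a c, cons_mul_cons b c,
            add_mul, map_add]
          abel
        have r : cons a u * (cons b v * cons c w) =
            cons a (u * (cons b v * cons c w)) + cons b (cons a u * (v * cons c w)) +
              cons c (cons a u * (cons b v * w)) := by
          rw [cons_mul_cons b c, mul_add, mul_add, cons_mul_cons a b, cons_mul_cons a c, map_add]
          abel
        rw [l, r]

theorem mul_assoc' (x y z : ShuffleAlgebra I) : x * y * z = x * (y * z) := by
  have h : shuffleMul.compr₂ (shuffleMul (I := I)) =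
      (LinearMap.llcomp ℂ _ _ _ ∘ₗ shuffleMul).compl₂ shuffleMul :=
    hom_ext fun u => hom_ext fun v => hom_ext fun w => by
      simpa [mul_eq] using mul_assoc_word u v w
  exact LinearMap.congr_fun (LinearMap.congr_fun₂ h x y) z

instance : CommRing (ShuffleAlgebra I) :=
  { (inferInstance : NonUnitalNonAssocCommRing (ShuffleAlgebra I)) with
    mul_assoc := mul_assoc'
    one_mul := one_mul'
    mul_one := fun x => by rw [mul_comm, one_mul'] }

instance : Algebra ℂ (ShuffleAlgebra I) :=
  Algebra.ofModule smul_mul' fun r x y => by rw [mul_comm, smul_mul', mul_comm]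

/-- Deconcatenation of words. -/
def deconcat : ShuffleAlgebra I →ₗ[ℂ] ShuffleAlgebra I ⊗[ℂ] ShuffleAlgebra I :=
  extend fun w => ∑ i ∈ Finset.range (w.length + 1), word (w.take i) ⊗ₜ[ℂ] word (w.drop i)

/-- The coefficient of the empty word. -/
def coeffNil : ShuffleAlgebra I →ₗ[ℂ] ℂ := extend fun w => if w.isEmpty then 1 else 0

/-- Word reversal with the sign of the length. -/
def signedReverse : ShuffleAlgebra I →ₗ[ℂ] ShuffleAlgebra I :=
  extend fun w => (-1 : ℂ) ^ w.length • word w.reverse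

theorem deconcat_cons (a : I) (x : ShuffleAlgebra I) :
    deconcat (cons a x) = 1 ⊗ₜ cons a x + (cons a).rTensor _ (deconcat x) := by
  have h : deconcat ∘ₗ cons a =
      TensorProduct.mk ℂ _ _ 1 ∘ₗ cons a + (cons a).rTensor (ShuffleAlgebra I) ∘ₗ deconcat :=
    hom_ext fun w => by
      simp [deconcat, one_eq, Finset.sum_range_succ', add_comm]
  exact LinearMap.congr_fun h x

theorem deconcat_one : deconcat (1 : ShuffleAlgebra I) = 1 ⊗ₜ 1 := by
  simp [deconcat, one_eq]

theorem coeffNil_cons (a : I) (x : ShuffleAlgebra I) : coeffNil (cons a x) = 0 := by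
  have h : coeffNil ∘ₗ cons a = 0 := hom_ext fun w => by simp [coeffNil]
  exact LinearMap.congr_fun h x

theorem coeffNil_one : coeffNil (1 : ShuffleAlgebra I) = 1 := by simp [coeffNil, one_eq]

set_option synthInstance.maxHeartbeats 200000 in
set_option maxHeartbeats 1000000 in
instance : Coalgebra ℂ (ShuffleAlgebra I) where
  comul := deconcat
  counit := coeffNil
  coassoc := hom_ext fun w => by
    induction w with
    | nil => simp [← one_eq, deconcat_one]
    | cons a w ih =>
      rw [← cons_word]
      simp only [LinearMap.comp_apply, LinearEquiv.coe_coe, deconcat_cons, map_add,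
        LinearMap.rTensor_tmul, LinearMap.lTensor_tmul, deconcat_one,
        TensorProduct.assoc_tmul, TensorProduct.tmul_add, add_assoc] at ih ⊢
      congr 1
      have h1 : ∀ t : ShuffleAlgebra I ⊗[ℂ] ShuffleAlgebra I,
          TensorProduct.assoc ℂ _ _ _ (deconcat.rTensor _ ((cons a).rTensor _ t)) =
          1 ⊗ₜ ((cons a).rTensor _ t) +
            (cons a).rTensor _ (TensorProduct.assoc ℂ _ _ _ (deconcat.rTensor _ t)) := by
        intro t
        induction t with
        | zero => simp
        | tmul x y =>
          simp only [LinearMap.rTensor_tmul, deconcat_cons, TensorProduct.add_tmul, map_add,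
            TensorProduct.assoc_tmul]
          congr 1
          generalize deconcat x = s
          induction s with
          | zero => simp
          | tmul p q => simp
          | add p q hp hq => simp only [TensorProduct.add_tmul, map_add, hp, hq]
        | add x y hx hy =>
          simp only [map_add, hx, hy, TensorProduct.tmul_add]; abel
      have h2 : ∀ t : ShuffleAlgebra I ⊗[ℂ] ShuffleAlgebra I,
          (deconcat (I := I)).lTensor _ ((cons a).rTensor _ t) =
            (cons a).rTensor _ (deconcat.lTensor _ t) := by
        intro t
        induction t with
        | zero => simp
        | tmul x y => simp
        | add x y hx hy => simp only [map_add, hx, hy]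
      rw [h1, h2, ih]
  rTensor_counit_comp_comul := hom_ext fun w => by
    cases w with
    | nil => simp [← one_eq, deconcat_one, coeffNil_one]
    | cons a w =>
      rw [← cons_word]
      have h : coeffNil.rTensor _ ∘ₗ (cons a).rTensor (ShuffleAlgebra I) = 0 := by
        rw [← LinearMap.rTensor_comp]
        have : coeffNil ∘ₗ cons a = 0 := LinearMap.ext (coeffNil_cons a)
        simp [this]
      have h' := LinearMap.congr_fun h (deconcat (word w))
      simp only [LinearMap.comp_apply, LinearMap.zero_apply] at h'
      simp only [LinearMap.comp_apply, deconcat_cons, map_add, LinearMap.rTensor_tmul,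
        coeffNil_one, h', add_zero]
      rfl
  lTensor_counit_comp_comul := hom_ext fun w => by
    induction w with
    | nil => simp [← one_eq, deconcat_one, coeffNil_one]
    | cons a w ih =>
      rw [← cons_word]
      have h : coeffNil.lTensor _ ∘ₗ (cons a).rTensor (ShuffleAlgebra I) =
          (cons a).rTensor _ ∘ₗ coeffNil.lTensor _ := by
        ext; simp
      have h' := LinearMap.congr_fun h (deconcat (word w))
      simp only [LinearMap.comp_apply] at h' ih
      simp only [LinearMap.comp_apply, deconcat_cons, map_add, LinearMap.lTensor_tmul,
        coeffNil_cons, h', TensorProduct.tmul_zero, zero_add, ih]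
      simp

theorem comul_eq (x : ShuffleAlgebra I) : Coalgebra.comul (R := ℂ) x = deconcat x := rfl

theorem counit_eq (x : ShuffleAlgebra I) : Coalgebra.counit (R := ℂ) x = coeffNil x := rfl

theorem rTensor_mul_rTensor (a b : I) (s t : ShuffleAlgebra I ⊗[ℂ] ShuffleAlgebra I) :
    (cons a).rTensor _ s * (cons b).rTensor _ t =
      (cons a).rTensor _ (s * (cons b).rTensor _ t) +
        (cons b).rTensor _ ((cons a).rTensor _ s * t) := by
  induction s with
  | zero => simp
  | add p q hp hq => simp only [map_add, add_mul, hp, hq]; abel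
  | tmul p q =>
    induction t with
    | zero => simp
    | add x y hx hy => simp only [map_add, mul_add, hx, hy]; abel
    | tmul x y => simp [cons_mul_cons, TensorProduct.add_tmul]

theorem one_tmul_mul_rTensor (b : I) (y : ShuffleAlgebra I)
    (t : ShuffleAlgebra I ⊗[ℂ] ShuffleAlgebra I) :
    (1 ⊗ₜ y) * (cons b).rTensor _ t = (cons b).rTensor _ ((1 ⊗ₜ y) * t) := by
  induction t with
  | zero => simp
  | add x y hx hy => simp only [map_add, mul_add, hx, hy]
  | tmul x y => simp

theorem deconcat_mul_word (u v : List I) :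
    deconcat (word u * word v) = deconcat (word u) * deconcat (word v) := by
  induction u generalizing v with
  | nil => simp [← one_eq, deconcat_one, ← Algebra.TensorProduct.one_def]
  | cons a u ihu =>
    induction v with
    | nil => simp [← one_eq, deconcat_one, ← Algebra.TensorProduct.one_def]
    | cons b v ihv =>
      have e := ihu (b :: v)
      simp only [← cons_word] at e ihv ⊢
      have hl : deconcat (cons a (word u) * cons b (word v)) =
          1 ⊗ₜ (cons a (word u) * cons b (word v)) +
            (cons a).rTensor _ (deconcat (word u) * deconcat (cons b (word v))) +
            (cons b).rTensor _ (deconcat (cons a (word u)) * deconcat (word v)) := by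
        rw [← e, ← ihv, cons_mul_cons, map_add, deconcat_cons, deconcat_cons,
          TensorProduct.tmul_add]
        abel
      rw [hl]
      simp only [deconcat_cons]
      generalize deconcat (word u) = s
      generalize deconcat (word v) = t
      rw [add_mul _ _ (_ + _), mul_add (1 ⊗ₜ _), mul_add ((cons a).rTensor _ _),
        rTensor_mul_rTensor, one_tmul_mul_rTensor, mul_comm ((cons a).rTensor _ s) (1 ⊗ₜ _),
        one_tmul_mul_rTensor, mul_add s, add_mul _ _ t, map_add, map_add,
        mul_comm s (1 ⊗ₜ _), Algebra.TensorProduct.tmul_mul_tmul, one_mul]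
      abel

theorem deconcat_mul (x y : ShuffleAlgebra I) :
    deconcat (x * y) = deconcat x * deconcat y := by
  have h : shuffleMul.compr₂ deconcat =
      (LinearMap.mul ℂ (ShuffleAlgebra I ⊗[ℂ] ShuffleAlgebra I)).compl₁₂ deconcat deconcat :=
    hom_ext fun u => hom_ext fun v => by simpa [mul_eq] using deconcat_mul_word u v
  exact LinearMap.congr_fun₂ h x y

theorem coeffNil_mul (x y : ShuffleAlgebra I) :
    coeffNil (x * y) = coeffNil x * coeffNil y := by
  have h : shuffleMul.compr₂ (coeffNil (I := I)) =
      (LinearMap.mul ℂ ℂ).compl₁₂ coeffNil coeffNil :=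
    hom_ext fun u => hom_ext fun v => by
      simp only [LinearMap.compr₂_apply, LinearMap.compl₁₂_apply, LinearMap.mul_apply', ← mul_eq]
      cases u with
      | nil => simp [← one_eq, coeffNil_one]
      | cons a u =>
        cases v with
        | nil => simp [← one_eq, coeffNil_one]
        | cons b v =>
          simp only [← cons_word]
          rw [cons_mul_cons, map_add]
          simp only [coeffNil_cons]; simp
  exact LinearMap.congr_fun₂ h x y

instance : Bialgebra ℂ (ShuffleAlgebra I) :=
  Bialgebra.mk' ℂ (ShuffleAlgebra I) coeffNil_one (coeffNil_mul _ _)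
    (deconcat_one.trans Algebra.TensorProduct.one_def.symm) (deconcat_mul _ _)

end ShuffleAlgebra

namespace ShuffleAlgebra
variable {I : Type*}

theorem snoc_cons (a b : I) (x : ShuffleAlgebra I) : snoc a (cons b x) = cons b (snoc a x) := by
  have h : snoc a ∘ₗ cons b = cons b ∘ₗ snoc a := hom_ext fun w => by simp
  exact LinearMap.congr_fun h x

theorem snoc_mul_snoc (a b : I) (u v : List I) :
    word (u ++ [a]) * word (v ++ [b]) =
      snoc a (word u * word (v ++ [b])) + snoc b (word (u ++ [a]) * word v) := by
  have base : ∀ (a b : I) (v : List I), word [a] * word (v ++ [b]) =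
      snoc a (word (v ++ [b])) + snoc b (word [a] * word v) := by
    intro a b v
    induction v with
    | nil =>
      have := word_cons_mul_word_cons a b [] []
      simp only [← one_eq, one_mul, mul_one] at this
      simp only [List.nil_append, this, ← one_eq, mul_one, cons_word, snoc_word, List.cons_append]
      abel
    | cons c v ih =>
      have h1 := word_cons_mul_word_cons a c [] (v ++ [b])
      have h2 := word_cons_mul_word_cons a c [] v
      simp only [← one_eq, one_mul] at h1 h2
      simp only [List.cons_append, h1, h2, ih, map_add, snoc_cons, cons_word, snoc_word]
      abel
  induction u generalizing v with
  | nil => simpa [← one_eq] using base a b v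
  | cons c u ihu =>
    induction v with
    | nil =>
      have := base b a (c :: u)
      simp only [List.nil_append, ← one_eq, mul_one]
      rw [mul_comm, this, mul_comm, add_comm]
    | cons d v ihv =>
      have e := ihu (d :: v)
      simp only [List.cons_append] at e ihv ⊢
      rw [word_cons_mul_word_cons, e, ihv, word_cons_mul_word_cons, word_cons_mul_word_cons]
      simp only [map_add, snoc_cons]
      abel

theorem sum_reverse_mul (c : I) (u v : List I) :
    ∑ i ∈ Finset.range (v.length + 1),
      (-1 : ℂ) ^ (v.take i).length • (word ((v.take i).reverse ++ c :: u) * word (v.drop i)) =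
    cons c (word u * word v) := by
  induction v generalizing c u with
  | nil => simp [← one_eq]
  | cons a v ih =>
    have h := ih a (c :: u)
    rw [List.length_cons, Finset.sum_range_succ']
    simp only [List.take_succ_cons, List.drop_succ_cons, List.length_cons, pow_succ, mul_neg_one,
      neg_smul, List.reverse_cons, List.append_assoc, List.singleton_append,
      Finset.sum_neg_distrib, h]
    simp only [List.take_zero, List.length_nil, pow_zero, one_smul, List.reverse_nil,
      List.nil_append, List.drop_zero]
    rw [word_cons_mul_word_cons]
    abel

theorem sum_mul_reverse (c : I) (u v : List I) :
    ∑ i ∈ Finset.range (v.length + 1),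
      (-1 : ℂ) ^ (v.drop i).length • (word (v.take i) * word (u ++ c :: (v.drop i).reverse)) =
    snoc c (word v * word u) := by
  induction v using List.reverseRecOn generalizing c u with
  | nil => simp [← one_eq]
  | append_singleton v a ih =>
    have h := ih a (u ++ [c])
    rw [List.length_append, List.length_singleton, Finset.sum_range_succ]
    have e : ∀ i ∈ Finset.range (v.length + 1),
        (-1 : ℂ) ^ ((v ++ [a]).drop i).length •
          (word ((v ++ [a]).take i) * word (u ++ c :: ((v ++ [a]).drop i).reverse)) =
        -((-1 : ℂ) ^ (v.drop i).length •
          (word (v.take i) * word ((u ++ [c]) ++ a :: (v.drop i).reverse))) := by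
      intro i hi
      have hi' : i ≤ v.length := by simpa [Nat.lt_succ_iff] using hi
      rw [List.take_append_of_le_length hi', List.drop_append_of_le_length hi']
      simp [pow_succ]
    rw [Finset.sum_congr rfl e, Finset.sum_neg_distrib, h]
    rw [List.take_of_length_le (by simp), List.drop_of_length_le (by simp)]
    simp only [List.length_nil, pow_zero, one_smul, List.reverse_nil]
    rw [snoc_mul_snoc]
    abel

instance : HopfAlgebra ℂ (ShuffleAlgebra I) where
  antipode := signedReverse
  mul_antipode_rTensor_comul := hom_ext fun w => by
    cases w with
    | nil =>
      simp only [← one_eq, LinearMap.comp_apply, Bialgebra.comul_one, Bialgebra.counit_one,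
        Algebra.TensorProduct.one_def]
      simp [signedReverse, one_eq, word_mul_word]
    | cons a w =>
      have h := sum_reverse_mul a [] w
      simp only [LinearMap.comp_apply, comul_eq, counit_eq]
      rw [← cons_word, coeffNil_cons, cons_word]
      simp only [deconcat, extend_word, map_sum, LinearMap.rTensor_tmul, LinearMap.mul'_apply,
        signedReverse, smul_mul_assoc, List.length_cons, map_zero]
      rw [Finset.sum_range_succ']
      simp only [List.take_succ_cons, List.drop_succ_cons, List.length_cons, pow_succ, mul_neg_one,
        neg_smul, List.reverse_cons, Finset.sum_neg_distrib, h]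
      simp [← one_eq]
  mul_antipode_lTensor_comul := hom_ext fun w => by
    induction w using List.reverseRecOn with
    | nil =>
      simp only [← one_eq, LinearMap.comp_apply, Bialgebra.comul_one, Bialgebra.counit_one,
        Algebra.TensorProduct.one_def]
      simp [signedReverse, one_eq, word_mul_word]
    | append_singleton w a _ =>
      have h := sum_mul_reverse a [] w
      simp only [LinearMap.comp_apply, comul_eq, counit_eq]
      simp only [deconcat, coeffNil, extend_word, map_sum, LinearMap.lTensor_tmul,
        LinearMap.mul'_apply, signedReverse, mul_smul_comm, List.length_append,
        List.length_singleton]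
      rw [Finset.sum_range_succ]
      have e : ∀ i ∈ Finset.range (w.length + 1),
          (-1 : ℂ) ^ ((w ++ [a]).drop i).length •
            (word ((w ++ [a]).take i) * word (((w ++ [a]).drop i).reverse)) =
          -((-1 : ℂ) ^ (w.drop i).length •
            (word (w.take i) * word ([] ++ a :: (w.drop i).reverse))) := by
        intro i hi
        have hi' : i ≤ w.length := by simpa [Nat.lt_succ_iff] using hi
        rw [List.take_append_of_le_length hi', List.drop_append_of_le_length hi']
        simp [pow_succ]
      rw [Finset.sum_congr rfl e, Finset.sum_neg_distrib, h]
      rw [List.take_of_length_le (by simp), List.drop_of_length_le (by simp)]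
      simp [← one_eq]

theorem antipode_word (w : List I) :
    HopfAlgebra.antipode ℂ (word w) = (-1 : ℂ) ^ w.length • word w.reverse :=
  extend_word _ w

end ShuffleAlgebra

namespace TensorAlgebra
variable {V : Type*} [AddCommGroup V] [Module ℂ V]

/-- The bialgebra structure on the tensor algebra for which the generators are primitive. -/
instance primitiveBialgebra : Bialgebra ℂ (TensorAlgebra ℂ V) :=
  .ofAlgHom
    (lift ℂ ((TensorProduct.mk ℂ _ _).flip 1 ∘ₗ ι ℂ + TensorProduct.mk ℂ _ _ 1 ∘ₗ ι ℂ))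
    (lift ℂ 0)
    (by
      ext x
      simp [Algebra.TensorProduct.one_def, TensorProduct.add_tmul, TensorProduct.tmul_add]
      abel)
    (by ext x; simp)
    (by ext x; simp)

theorem comul_ι (x : V) :
    Coalgebra.comul (R := ℂ) (ι ℂ x) = ι ℂ x ⊗ₜ[ℂ] 1 + 1 ⊗ₜ[ℂ] ι ℂ x :=
  lift_ι_apply _ x

theorem counit_ι (x : V) : Coalgebra.counit (R := ℂ) (ι ℂ x) = 0 :=
  lift_ι_apply _ x

/-- The anti-automorphism of the tensor algebra with `v ↦ -v` on generators. -/
def negReverse : TensorAlgebra ℂ V →ₗ[ℂ] TensorAlgebra ℂ V :=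
  (MulOpposite.opLinearEquiv ℂ).symm.toLinearMap ∘ₗ
    (lift ℂ (-((MulOpposite.opLinearEquiv ℂ).toLinearMap ∘ₗ ι ℂ)) :
      TensorAlgebra ℂ V →ₐ[ℂ] (TensorAlgebra ℂ V)ᵐᵒᵖ).toLinearMap

theorem negReverse_ι (x : V) : negReverse (ι ℂ x) = -ι ℂ x := by simp [negReverse]

theorem negReverse_mul (x y : TensorAlgebra ℂ V) :
    negReverse (x * y) = negReverse y * negReverse x := by simp [negReverse]

theorem negReverse_one : negReverse (1 : TensorAlgebra ℂ V) = 1 := by simp [negReverse]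

theorem left_induction {p : TensorAlgebra ℂ V → Prop} (one : p 1)
    (add : ∀ x y, p x → p y → p (x + y)) (smul : ∀ (r : ℂ) x, p x → p (r • x))
    (ι_mul : ∀ v x, p x → p (ι ℂ v * x)) (x : TensorAlgebra ℂ V) : p x := by
  suffices h : ∀ y, p y → p (x * y) by simpa using h 1 one
  induction x using TensorAlgebra.induction with
  | algebraMap r => intro y hy; rw [← Algebra.smul_def]; exact smul r y hy
  | ι v => exact fun y hy => ι_mul v y hy
  | mul a b ha hb => intro y hy; rw [mul_assoc]; exact ha _ (hb _ hy)
  | add a b ha hb => intro y hy; rw [add_mul]; exact add _ _ (ha _ hy) (hb _ hy)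

theorem right_induction {p : TensorAlgebra ℂ V → Prop} (one : p 1)
    (add : ∀ x y, p x → p y → p (x + y)) (smul : ∀ (r : ℂ) x, p x → p (r • x))
    (mul_ι : ∀ v x, p x → p (x * ι ℂ v)) (x : TensorAlgebra ℂ V) : p x := by
  suffices h : ∀ y, p y → p (y * x) by simpa using h 1 one
  induction x using TensorAlgebra.induction with
  | algebraMap r =>
    intro y hy; rw [← Algebra.commutes, ← Algebra.smul_def]; exact smul r y hy
  | ι v => exact fun y hy => mul_ι v y hy
  | mul a b ha hb => intro y hy; rw [← mul_assoc]; exact hb _ (ha _ hy)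
  | add a b ha hb => intro y hy; rw [mul_add]; exact add _ _ (ha _ hy) (hb _ hy)

instance primitiveHopfAlgebra : HopfAlgebra ℂ (TensorAlgebra ℂ V) where
  antipode := negReverse
  mul_antipode_rTensor_comul := LinearMap.ext fun x => by
    induction x using left_induction with
    | one => simp [Algebra.TensorProduct.one_def, negReverse_one]
    | add x y hx hy => simp only [map_add, hx, hy]
    | smul r x hx => simp only [map_smul, hx]
    | ι_mul v x _ =>
      simp only [LinearMap.comp_apply, Bialgebra.comul_mul, Bialgebra.counit_mul, counit_ι,
        comul_ι, zero_mul, map_zero]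
      generalize Coalgebra.comul (R := ℂ) x = t
      induction t with
      | zero => simp
      | add s t hs ht => simp only [mul_add, map_add, hs, ht, add_zero]
      | tmul p q => simp [add_mul, negReverse_mul, negReverse_ι, mul_assoc]
  mul_antipode_lTensor_comul := LinearMap.ext fun x => by
    induction x using right_induction with
    | one => simp [Algebra.TensorProduct.one_def, negReverse_one]
    | add x y hx hy => simp only [map_add, hx, hy]
    | smul r x hx => simp only [map_smul, hx]
    | mul_ι v x _ =>
      simp only [LinearMap.comp_apply, Bialgebra.comul_mul, Bialgebra.counit_mul, counit_ι,
        comul_ι, mul_zero, map_zero]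
      generalize Coalgebra.comul (R := ℂ) x = t
      induction t with
      | zero => simp
      | add s t hs ht => simp only [add_mul, map_add, hs, ht, add_zero]
      | tmul p q => simp [mul_add, negReverse_mul, negReverse_ι, mul_assoc]

end TensorAlgebra

namespace SymmetricAlgebra
variable {V : Type*} [AddCommGroup V] [Module ℂ V]

/-- The antipode of the symmetric algebra is the algebra automorphism `v ↦ -v`. -/
instance primitiveHopfAlgebra : HopfAlgebra ℂ (SymmetricAlgebra ℂ V) where
  antipode := (lift (-ι ℂ V)).toLinearMap
  mul_antipode_rTensor_comul := by
    have h : ((Algebra.TensorProduct.lmul' ℂ).comp (Algebra.TensorProduct.map (lift (-ι ℂ V))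
        (.id ℂ _))).comp (Bialgebra.comulAlgHom ℂ (SymmetricAlgebra ℂ V)) =
        (Algebra.ofId ℂ _).comp (Bialgebra.counitAlgHom ℂ _) := by
      ext x; simp [algebraMapInv_ι]
    exact congrArg AlgHom.toLinearMap h
  mul_antipode_lTensor_comul := by
    have h : ((Algebra.TensorProduct.lmul' ℂ).comp (Algebra.TensorProduct.map (.id ℂ _)
        (lift (-ι ℂ V)))).comp (Bialgebra.comulAlgHom ℂ (SymmetricAlgebra ℂ V)) =
        (Algebra.ofId ℂ _).comp (Bialgebra.counitAlgHom ℂ _) := by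
      ext x; simp [algebraMapInv_ι]
    exact congrArg AlgHom.toLinearMap h

end SymmetricAlgebra

namespace QuasiSymmetric

/-- Formal power series of bounded degree in commuting variables `x 0, x 1, x 2, …`. -/
def boundedDegree : Subalgebra ℂ (MvPowerSeries ℕ ℂ) where
  carrier := {f | ∃ N : ℕ, ∀ m : ℕ →₀ ℕ, N < m.degree → MvPowerSeries.coeff m f = 0}
  mul_mem' := by
    classical
    rintro f g ⟨M, hM⟩ ⟨N, hN⟩
    refine ⟨M + N, fun m hm => ?_⟩
    rw [MvPowerSeries.coeff_mul]
    refine Finset.sum_eq_zero fun p hp => ?_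
    rw [Finset.HasAntidiagonal.mem_antidiagonal] at hp
    rw [← hp, map_add] at hm
    rcases lt_or_ge M p.1.degree with h | h
    · rw [hM _ h, zero_mul]
    · rw [hN _ (by omega), mul_zero]
  add_mem' := by
    rintro f g ⟨M, hM⟩ ⟨N, hN⟩
    refine ⟨M + N, fun m hm => ?_⟩
    rw [map_add, hM _ (by omega), hN _ (by omega), add_zero]
  algebraMap_mem' r := by
    classical
    refine ⟨0, fun m hm => ?_⟩
    rw [MvPowerSeries.algebraMap_apply, Algebra.algebraMap_self_apply, MvPowerSeries.coeff_C,
      if_neg]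
    rintro rfl
    simp at hm

/-- The value `f (1, 0, 0, …)` of a power series of bounded degree: the (finite) sum of the
coefficients of the monomials `(x 0) ^ k`. -/
def evalOneZero (f : boundedDegree) : ℂ :=
  ∑ᶠ k : ℕ, MvPowerSeries.coeff (Finsupp.single 0 k) (f : MvPowerSeries ℕ ℂ)

theorem exists_polynomial (f : boundedDegree) : ∃ p : Polynomial ℂ, ∀ k,
    p.coeff k = MvPowerSeries.coeff (Finsupp.single 0 k) (f : MvPowerSeries ℕ ℂ) := by
  obtain ⟨f, N, hN⟩ := f
  refine ⟨∑ k ∈ Finset.range (N + 1),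
    Polynomial.monomial k (MvPowerSeries.coeff (Finsupp.single 0 k) f), fun k => ?_⟩
  rw [Polynomial.finsetSum_coeff]
  simp only [Polynomial.coeff_monomial, Finset.sum_ite_eq', Finset.mem_range]
  split_ifs with h
  · rfl
  · exact (hN _ (by rw [Finsupp.degree_single]; omega)).symm

theorem evalOneZero_eq_eval {f : boundedDegree} {p : Polynomial ℂ}
    (h : ∀ k, p.coeff k = MvPowerSeries.coeff (Finsupp.single 0 k) (f : MvPowerSeries ℕ ℂ)) :
    evalOneZero f = p.eval 1 := by
  simp only [evalOneZero, ← h]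
  rw [Polynomial.eval_eq_sum, Polynomial.sum, finsum_eq_sum_of_support_subset (s := p.support)]
  · simp
  · intro k hk; simpa using hk

/-- The character `f ↦ f (1, 0, 0, …)`. -/
def zeta : boundedDegree →ₐ[ℂ] ℂ where
  toFun := evalOneZero
  map_one' := by
    classical
    rw [evalOneZero_eq_eval (p := 1), Polynomial.eval_one]
    intro k
    simp [Polynomial.coeff_one, MvPowerSeries.coeff_one]
  map_mul' f g := by
    classical
    obtain ⟨p, hp⟩ := exists_polynomial f
    obtain ⟨q, hq⟩ := exists_polynomial g
    rw [evalOneZero_eq_eval hp, evalOneZero_eq_eval hq, ← Polynomial.eval_mul]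
    refine evalOneZero_eq_eval fun k => ?_
    rw [Polynomial.coeff_mul, MulMemClass.coe_mul, MvPowerSeries.coeff_mul,
      Finsupp.antidiagonal_single, Finset.sum_map]
    refine Finset.sum_congr rfl fun x _ => ?_
    rw [hp, hq]; rfl
  map_zero' := by
    rw [evalOneZero_eq_eval (p := 0), Polynomial.eval_zero]
    intro k; simp
  map_add' f g := by
    obtain ⟨p, hp⟩ := exists_polynomial f
    obtain ⟨q, hq⟩ := exists_polynomial g
    rw [evalOneZero_eq_eval hp, evalOneZero_eq_eval hq, ← Polynomial.eval_add]
    refine evalOneZero_eq_eval fun k => ?_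
    rw [Polynomial.coeff_add, hp, hq]; simp
  commutes' r := by
    classical
    rw [evalOneZero_eq_eval (p := Polynomial.C r), Polynomial.eval_C]
    · rfl
    intro k
    simp [Polynomial.coeff_C, MvPowerSeries.algebraMap_apply, MvPowerSeries.coeff_C]

/-- The monomial quasisymmetric function `M_α = ∑_{i₁ < ⋯ < i_ℓ} x_{i₁}^{α₁} ⋯ x_{i_ℓ}^{α_ℓ}` of a
composition `α`, i.e. of a list of positive integers: the sum of all monomials whose nonzero
exponents, read in increasing order of the variables, form the list `α`. -/
def monomialFun (α : List ℕ) : boundedDegree :=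
  ⟨fun m : ℕ →₀ ℕ => if (m.support.sort).map m = α then (1 : ℂ) else 0, α.sum, fun m hm => by
    change (if _ then _ else _) = _
    rw [if_neg]
    rintro rfl
    rw [Finsupp.degree_apply, ← List.sum_toFinset _ (Finset.sort_nodup _ _),
      Finset.sort_toFinset] at hm
    exact lt_irrefl _ hm⟩

/-- The scaled power sum `p_n = (1 / n) M_n`. -/
def powerSum (n : ℕ) : boundedDegree := (1 / n : ℂ) • monomialFun [n]

/-- A list of integers has no odd entry directly followed by an even entry. -/
def NoOddToEven (α : List ℕ) : Prop := α.IsChain fun a b => ¬ (Odd a ∧ Even b)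

/-- `1 / (O! E!)`, with `O` and `E` the numbers of odd and of even entries of a list. -/
def blockCoeff (α : List ℕ) : ℂ :=
  1 / (((α.countP fun a => decide (Odd a)).factorial : ℂ) *
    ((α.countP fun a => decide (Even a)).factorial : ℂ))

open Classical in
/-- The shuffle function `S_α = ∑_β c_α^β M_β` of a composition `α`. A composition `β` with
`β ≤ α` (refined by `α`) arises by cutting the list `α` into consecutive nonempty blocks and
summing each block. The sum is over those `β` for which `α` is cut at least at all places where an
odd part is followed by an even part, and `c_α^β` is the product over the blocks of `1 / (O! E!)`.
-/
def shuffleFun (α : List ℕ) : boundedDegree :=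
  ∑ c : Composition α.length,
    if ∀ B ∈ α.splitWrtComposition c, NoOddToEven B then
      ((α.splitWrtComposition c).map blockCoeff).prod •
        monomialFun ((α.splitWrtComposition c).map List.sum)
    else 0

theorem zeta_monomialFun_nil : zeta (monomialFun []) = 1 := by
  classical
  refine (evalOneZero_eq_eval (p := 1) fun k => ?_).trans Polynomial.eval_one
  rw [Polynomial.coeff_one]
  change _ = if _ then _ else _
  by_cases hk : k = 0
  · simp [hk]
  · rw [if_neg hk, if_neg]
    rw [Finsupp.support_single _ hk]
    simp

theorem sort_single {k : ℕ} (hk : k ≠ 0) :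
    ((Finsupp.single 0 k : ℕ →₀ ℕ).support.sort).map (Finsupp.single 0 k : ℕ →₀ ℕ) = [k] := by
  rw [Finsupp.support_single _ hk]
  simp

theorem zeta_monomialFun_singleton {n : ℕ} (hn : n ≠ 0) : zeta (monomialFun [n]) = 1 := by
  classical
  refine (evalOneZero_eq_eval (p := Polynomial.X ^ n) fun k => ?_).trans (by simp)
  rw [Polynomial.coeff_X_pow]
  change _ = if _ then _ else _
  by_cases hk : k = 0
  · subst hk; rw [if_neg hn.symm, if_neg]; simp
  · rw [sort_single hk]; simp

theorem zeta_monomialFun_of_length {α : List ℕ} (h : 2 ≤ α.length) : zeta (monomialFun α) = 0 := by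
  classical
  refine (evalOneZero_eq_eval (p := 0) fun k => ?_).trans (by simp)
  rw [Polynomial.coeff_zero]
  change _ = if _ then _ else _
  rw [if_neg]
  rintro rfl
  by_cases hk : k = 0
  · subst hk; simp at h
  · rw [sort_single hk] at h; simp at h

open Classical in
theorem zeta_shuffleFun {α : List ℕ} (hα : ∀ a ∈ α, 0 < a) :
    zeta (shuffleFun α) = if NoOddToEven α then blockCoeff α else 0 := by
  rw [shuffleFun, map_sum]
  rcases α with _ | ⟨a, t⟩
  · have hu : ∀ c : Composition ([] : List ℕ).length,
        ([] : List ℕ).splitWrtComposition c = [] := fun c =>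
      List.length_eq_zero_iff.mp (by
        rw [List.length_splitWrtComposition]
        exact Nat.le_zero.mp c.length_le)
    have hs : ∀ c : Composition ([] : List ℕ).length, c = Composition.ones _ := fun c =>
      Composition.ext ((List.length_eq_zero_iff.mp (Nat.le_zero.mp c.length_le)).trans
        (List.length_eq_zero_iff.mp
          (Nat.le_zero.mp (Composition.ones ([] : List ℕ).length).length_le)).symm)
    rw [Finset.sum_eq_single (Composition.ones ([] : List ℕ).length)
      (fun c _ hc => absurd (hs c) hc) (fun h => absurd (Finset.mem_univ _) h), hu]
    simp [zeta_monomialFun_nil, NoOddToEven, blockCoeff]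
  · set α := a :: t with hαt
    have hl : 0 < α.length := by simp [hαt]
    have hs : α.splitWrtComposition (Composition.single α.length hl) = [α] := by
      have h1 := α.length_splitWrtComposition (Composition.single α.length hl)
      rw [Composition.single_length] at h1
      obtain ⟨x, hx⟩ := List.length_eq_one_iff.mp h1
      have h2 := α.flatten_splitWrtComposition (Composition.single α.length hl)
      rw [hx] at h2 ⊢
      simpa using h2
    rw [Finset.sum_eq_single (Composition.single α.length hl)]
    · rw [hs]
      have hsum : α.sum ≠ 0 := by
        have := hα a (by simp [hαt])
        simp only [hαt, List.sum_cons]; omega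
      simp only [List.mem_singleton, forall_eq, List.map_cons, List.map_nil, List.prod_singleton]
      split_ifs with h
      · rw [map_smul, zeta_monomialFun_singleton hsum, smul_eq_mul, mul_one]
      · exact map_zero _
    · intro c _ hc
      split_ifs with h
      · rw [map_smul, zeta_monomialFun_of_length, smul_zero]
        rw [List.length_map, List.length_splitWrtComposition]
        have h1 : c.length ≠ 1 := fun h => hc ((Composition.eq_single_iff_length hl).mpr h)
        have h0 : 0 < c.length := Composition.length_pos_of_pos c hl
        omega
      · exact map_zero _
    · intro h; exact absurd (Finset.mem_univ _) h

end QuasiSymmetric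

namespace ShuffleAlgebra
variable {I : Type*}

theorem perm_of_mem_shuffles {u v w : List I} (h : w ∈ shuffles u v) : w.Perm (u ++ v) := by
  induction u generalizing v w with
  | nil => simp_all
  | cons a u ihu =>
    induction v generalizing w with
    | nil => simp_all
    | cons b v ihv =>
      rw [shuffles_cons_cons, Multiset.mem_add, Multiset.mem_map, Multiset.mem_map] at h
      rcases h with ⟨x, hx, rfl⟩ | ⟨x, hx, rfl⟩
      · exact (ihu hx).cons a
      · exact ((ihv hx).cons b).trans List.perm_middle.symm

theorem card_shuffles (u v : List I) :
    (shuffles u v).card = (u.length + v.length).choose u.length := by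
  induction u generalizing v with
  | nil => simp
  | cons a u ihu =>
    induction v with
    | nil => simp
    | cons b v ihv =>
      rw [shuffles_cons_cons, Multiset.card_add, Multiset.card_map, Multiset.card_map, ihu, ihv]
      simp only [List.length_cons]
      rw [show u.length + 1 + (v.length + 1) = (u.length + (v.length + 1)) + 1 by ring,
        Nat.choose_succ_succ, show u.length + 1 + v.length = u.length + (v.length + 1) by ring]

open Classical in
/-- `1 / ℓ!` on words of length `ℓ` with all letters satisfying `P`, and `0` on other words. -/
def expChar (P : I → Prop) : ShuffleAlgebra I →ₐ[ℂ] ℂ :=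
  AlgHom.ofLinearMap
    (extend fun w => if ∀ i ∈ w, P i then 1 / (w.length.factorial : ℂ) else 0)
    (by simp [one_eq])
    (fun x y => by
      set f : List I → ℂ := fun w => if ∀ i ∈ w, P i then 1 / (w.length.factorial : ℂ) else 0
        with hf
      have hperm : ∀ {u v : List I}, u.Perm v → f u = f v := by
        intro u v h
        simp only [hf, h.mem_iff, h.length_eq]
      have h : shuffleMul.compr₂ (extend f) =
          (LinearMap.mul ℂ ℂ).compl₁₂ (extend f) (extend f) :=
        hom_ext fun u => hom_ext fun v => by
          simp only [LinearMap.compr₂_apply, LinearMap.compl₁₂_apply, LinearMap.mul_apply',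
            ← mul_eq, word_mul_word, extend_word, map_multiset_sum, Multiset.map_map,
            Function.comp_def]
          rw [Multiset.map_congr rfl fun w hw => hperm (perm_of_mem_shuffles hw),
            Multiset.map_const', Multiset.sum_replicate, card_shuffles, nsmul_eq_mul]
          simp only [hf, List.mem_append, or_imp, forall_and, List.length_append]
          by_cases hu : ∀ i ∈ u, P i
          swap
          · rw [if_neg hu, if_neg fun h => hu h.1]; simp
          by_cases hv : ∀ i ∈ v, P i
          swap
          · rw [if_neg hv, if_neg fun h => hv h.2]; simp
          rw [if_pos hu, if_pos hv, if_pos ⟨hu, hv⟩]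
          have := Nat.choose_mul_factorial_mul_factorial (Nat.le_add_right u.length v.length)
          rw [Nat.add_sub_cancel_left] at this
          have h1 : (u.length.factorial : ℂ) ≠ 0 := by exact_mod_cast Nat.factorial_ne_zero _
          have h2 : (v.length.factorial : ℂ) ≠ 0 := by exact_mod_cast Nat.factorial_ne_zero _
          have h3 : ((u.length + v.length).factorial : ℂ) ≠ 0 := by
            exact_mod_cast Nat.factorial_ne_zero _
          field_simp
          exact_mod_cast this
      exact LinearMap.congr_fun₂ h x y)

open Classical in
theorem expChar_word (P : I → Prop) (w : List I) :
    expChar P (word w) = if ∀ i ∈ w, P i then 1 / (w.length.factorial : ℂ) else 0 :=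
  extend_word _ w

theorem odd_of_noOddToEven {a : ℕ} {t : List ℕ} (h : QuasiSymmetric.NoOddToEven (a :: t))
    (ha : Odd a) : ∀ b ∈ t, Odd b := by
  induction t generalizing a with
  | nil => simp
  | cons b t ih =>
    rw [QuasiSymmetric.NoOddToEven, List.isChain_cons_cons] at h
    have hb : Odd b := by
      rw [← Nat.not_even_iff_odd]; exact fun h' => h.1 ⟨ha, h'⟩
    intro c hc
    rcases List.mem_cons.mp hc with rfl | hc
    · exact hb
    · exact ih h.2 hb c hc

theorem noOddToEven_of_odd {t : List ℕ} (h : ∀ b ∈ t, Odd b) : QuasiSymmetric.NoOddToEven t := by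
  induction t with
  | nil => exact List.isChain_nil
  | cons a t ih =>
    rw [QuasiSymmetric.NoOddToEven, List.isChain_cons]
    refine ⟨fun b hb hab => ?_, ih fun b hb => h b (List.mem_cons_of_mem _ hb)⟩
    exact (Nat.not_even_iff_odd.mpr
      (h b (List.mem_cons_of_mem _ (List.mem_of_mem_head? hb)))) hab.2

theorem noOddToEven_iff (α : List ℕ) (i : ℕ) (hi : i ≤ α.length) :
    ((∀ a ∈ α.take i, Even a) ∧ (∀ a ∈ α.drop i, Odd a)) ↔
      QuasiSymmetric.NoOddToEven α ∧ i = α.countP fun a => decide (Even a) := by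
  induction α generalizing i with
  | nil => simp_all [QuasiSymmetric.NoOddToEven]
  | cons a t ih =>
    rcases i with _ | i
    · have hc : 0 = (a :: t).countP (fun a => decide (Even a)) ↔ ∀ b ∈ a :: t, Odd b := by
        rw [eq_comm, List.countP_eq_zero]
        simp only [decide_eq_true_eq, Nat.not_even_iff_odd]
      rw [hc]
      simp only [List.take_zero, List.drop_zero, List.not_mem_nil, false_imp_iff, implies_true,
        true_and]
      exact ⟨fun h => ⟨noOddToEven_of_odd h, h⟩, fun h => h.2⟩
    · have h := ih i (by simpa using hi)
      simp only [List.take_succ_cons, List.drop_succ_cons, List.forall_mem_cons]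
      rcases Nat.even_or_odd a with ha | ha
      · rw [List.countP_cons_of_pos (by simpa using ha), Nat.add_right_cancel_iff]
        have hn : QuasiSymmetric.NoOddToEven (a :: t) ↔ QuasiSymmetric.NoOddToEven t := by
          rw [QuasiSymmetric.NoOddToEven, List.isChain_cons]
          refine ⟨fun h => h.2, fun h => ⟨fun b _ hab => ?_, h⟩⟩
          exact Nat.not_even_iff_odd.mpr hab.1 ha
        rw [hn, ← h]
        simp [ha]
      · have ha' : ¬ Even a := Nat.not_even_iff_odd.mpr ha
        refine ⟨fun h => absurd h.1.1 ha', fun h => ?_⟩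
        have hodd := odd_of_noOddToEven h.1 ha
        have : (a :: t).countP (fun a => decide (Even a)) = 0 := by
          rw [List.countP_eq_zero]
          intro b hb
          simp only [decide_eq_true_eq, Nat.not_even_iff_odd]
          rcases List.mem_cons.mp hb with rfl | hb
          exacts [ha, hodd b hb]
        omega

/-- The linear map `v_α ↦ S_{deg α}` to quasisymmetric functions. -/
def toQSym (deg : I → ℕ+) : ShuffleAlgebra I →ₗ[ℂ] QuasiSymmetric.boundedDegree :=
  extend fun w => QuasiSymmetric.shuffleFun (w.map fun i => (deg i : ℕ))

theorem zeta_toQSym (deg : I → ℕ+) :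
    QuasiSymmetric.zeta.toLinearMap ∘ₗ toQSym deg =
      (WithConv.toConv (expChar fun i => Even (deg i : ℕ)) *
        WithConv.toConv (expChar fun i => Odd (deg i : ℕ))).ofConv.toLinearMap := by
  classical
  refine hom_ext fun w => ?_
  have hpos : ∀ a ∈ w.map fun i => (deg i : ℕ), 0 < a := by
    simp only [List.mem_map]; rintro _ ⟨i, _, rfl⟩; exact (deg i).pos
  have hr : (WithConv.toConv (expChar fun i => Even (deg i : ℕ)) *
        WithConv.toConv (expChar fun i => Odd (deg i : ℕ))).ofConv (word w) =
      ∑ i ∈ Finset.range (w.length + 1), expChar (fun i => Even (deg i : ℕ)) (word (w.take i)) *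
        expChar (fun i => Odd (deg i : ℕ)) (word (w.drop i)) := by
    rw [← AlgHom.coe_toLinearMap]
    change (WithConv.toConv (expChar fun i => Even (deg i : ℕ)) *
        WithConv.toConv (expChar fun i => Odd (deg i : ℕ))) (word w) = _
    rw [AlgHom.convMul_apply, comul_eq, deconcat, extend_word, map_sum]
    simp
  rw [AlgHom.toLinearMap_apply, hr, LinearMap.comp_apply, toQSym, extend_word,
    AlgHom.toLinearMap_apply, QuasiSymmetric.zeta_shuffleFun hpos]
  set α := w.map fun i => (deg i : ℕ) with hα
  have hlen : α.length = w.length := by simp [hα]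
  have key : ∀ i ∈ Finset.range (w.length + 1),
      expChar (fun i => Even (deg i : ℕ)) (word (w.take i)) *
        expChar (fun i => Odd (deg i : ℕ)) (word (w.drop i)) =
      if i = α.countP (fun a => decide (Even a)) then
        if QuasiSymmetric.NoOddToEven α then QuasiSymmetric.blockCoeff α else 0 else 0 := by
    intro i hi
    have hi' : i ≤ w.length := by simpa [Nat.lt_succ_iff] using hi
    have h := noOddToEven_iff α i (by omega)
    rw [expChar_word, expChar_word]
    have e1 : (∀ a ∈ α.take i, Even a) ↔ ∀ j ∈ w.take i, Even (deg j : ℕ) := by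
      simp [hα, ← List.map_take]
    have e2 : (∀ a ∈ α.drop i, Odd a) ↔ ∀ j ∈ w.drop i, Odd (deg j : ℕ) := by
      simp [hα, ← List.map_drop]
    rw [e1, e2] at h
    by_cases hc : i = α.countP (fun a => decide (Even a))
    · rw [if_pos hc]
      by_cases hn : QuasiSymmetric.NoOddToEven α
      · obtain ⟨h1, h2⟩ := h.mpr ⟨hn, hc⟩
        rw [if_pos h1, if_pos h2, if_pos hn, QuasiSymmetric.blockCoeff, ← hc]
        have ho : α.countP (fun a => decide (Odd a)) = w.length - i := by
          have := List.length_eq_countP_add_countP (fun a => decide (Even a)) (l := α)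
          simp only [decide_eq_true_eq, Nat.not_even_iff_odd] at this
          omega
        rw [ho, List.length_take, List.length_drop, min_eq_left hi']
        field_simp
      · rw [if_neg hn]
        have : ¬ ((∀ j ∈ w.take i, Even (deg j : ℕ)) ∧ ∀ j ∈ w.drop i, Odd (deg j : ℕ)) :=
          fun h' => hn (h.mp h').1
        rw [not_and_or] at this
        rcases this with h' | h' <;> simp only [if_neg h', zero_mul, mul_zero]
    · rw [if_neg hc]
      have : ¬ ((∀ j ∈ w.take i, Even (deg j : ℕ)) ∧ ∀ j ∈ w.drop i, Odd (deg j : ℕ)) :=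
        fun h' => hc (h.mp h').2
      rw [not_and_or] at this
      rcases this with h' | h' <;> simp only [if_neg h', zero_mul, mul_zero]
  rw [Finset.sum_congr rfl key, Finset.sum_ite_eq']
  refine (if_pos ?_).symm
  rw [Finset.mem_range, Nat.lt_succ_iff, ← hlen]
  exact List.countP_le_length

/-- The canonical character of the shuffle algebra. -/
def canonicalChar (deg : I → ℕ+) : ShuffleAlgebra I →ₐ[ℂ] ℂ :=
  AlgHom.ofLinearMap (QuasiSymmetric.zeta.toLinearMap ∘ₗ toQSym deg)
    (by rw [zeta_toQSym, AlgHom.toLinearMap_apply, map_one])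
    (fun x y => by simp only [zeta_toQSym, AlgHom.toLinearMap_apply, map_mul])

end ShuffleAlgebra

/-- The degree `n` part `⨁_{i + j = n} 𝒜 i ⊗ 𝒜 j` of `H ⊗ H`. -/
def tensorGrading {H : Type*} [AddCommGroup H] [Module ℂ H] (𝒜 : ℕ → Submodule ℂ H) (n : ℕ) :
    Submodule ℂ (H ⊗[ℂ] H) :=
  ⨆ (p : ℕ × ℕ) (_ : p.1 + p.2 = n),
    LinearMap.range (TensorProduct.map (𝒜 p.1).subtype (𝒜 p.2).subtype)

/-- A (complex) combinatorial Hopf algebra: a graded connected Hopf algebra with a character. -/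
structure CombinatorialHopfAlgebra (H : Type*) [Ring H] [HopfAlgebra ℂ H] where
  /-- The homogeneous components. -/
  grading : ℕ → Submodule ℂ H
  [gradedAlgebra : GradedAlgebra grading]
  comul_mem : ∀ n, ∀ x ∈ grading n, Coalgebra.comul (R := ℂ) x ∈ tensorGrading grading n
  counit_eq_zero : ∀ n, n ≠ 0 → ∀ x ∈ grading n, Coalgebra.counit (R := ℂ) x = 0
  antipode_mem : ∀ n, ∀ x ∈ grading n, HopfAlgebra.antipode ℂ x ∈ grading n
  connected : grading 0 = Submodule.span ℂ {1}
  /-- The character. -/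
  char : H →ₐ[ℂ] ℂ

/-- A subspace `C` of a coalgebra is a subcoalgebra if `Δ(C) ⊆ C ⊗ C`. -/
def IsSubcoalgebra {H : Type*} [AddCommGroup H] [Module ℂ H] [Coalgebra ℂ H]
    (C : Submodule ℂ H) : Prop :=
  ∀ x ∈ C, Coalgebra.comul (R := ℂ) x ∈ LinearMap.range (TensorProduct.map C.subtype C.subtype)

/-- The largest subcoalgebra contained in a subspace `K`, as the sum of all of them. -/
def largestSubcoalgebra {H : Type*} [AddCommGroup H] [Module ℂ H] [Coalgebra ℂ H]
    (K : Submodule ℂ H) : Submodule ℂ H :=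
  sSup {C | IsSubcoalgebra C ∧ C ≤ K}

theorem isGreatest_largestSubcoalgebra {H : Type*} [AddCommGroup H] [Module ℂ H] [Coalgebra ℂ H]
    (K : Submodule ℂ H) :
    IsGreatest {C : Submodule ℂ H | IsSubcoalgebra C ∧ C ≤ K} (largestSubcoalgebra K) := by
  refine ⟨⟨?_, sSup_le fun C hC => hC.2⟩, fun C hC => le_sSup hC⟩
  suffices h : largestSubcoalgebra K ≤ Submodule.comap (Coalgebra.comul (R := ℂ) (A := H))
      (LinearMap.range (TensorProduct.map (largestSubcoalgebra K).subtype
        (largestSubcoalgebra K).subtype)) from fun x hx => h hx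
  refine sSup_le fun C hC x hx => ?_
  have hle : C ≤ largestSubcoalgebra K := le_sSup hC
  obtain ⟨t, ht⟩ := hC.1 x hx
  refine ⟨TensorProduct.map (Submodule.inclusion hle) (Submodule.inclusion hle) t, ?_⟩
  rw [← ht, ← LinearMap.comp_apply, ← TensorProduct.map_comp, Submodule.subtype_comp_inclusion]

namespace CombinatorialHopfAlgebra

variable {H : Type*} [Ring H] [HopfAlgebra ℂ H] (A : CombinatorialHopfAlgebra H)

/-- For a functional `φ`, the functional `φ̄` with `φ̄ = (-1) ^ n φ` in degree `n`. -/
def bar (φ : H →ₗ[ℂ] ℂ) : H →ₗ[ℂ] ℂ :=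
  letI := A.gradedAlgebra
  DirectSum.toModule ℂ ℕ ℂ (fun n => (-1 : ℂ) ^ n • φ ∘ₗ (A.grading n).subtype) ∘ₗ
    (DirectSum.decomposeLinearEquiv A.grading).toLinearMap

theorem bar_apply_of_mem (φ : H →ₗ[ℂ] ℂ) {n : ℕ} {x : H} (hx : x ∈ A.grading n) :
    A.bar φ x = (-1 : ℂ) ^ n * φ x := by
  let := A.gradedAlgebra
  have h : DirectSum.decomposeLinearEquiv A.grading x =
      DirectSum.lof ℂ ℕ (fun i => A.grading i) n ⟨x, hx⟩ :=
    DirectSum.decomposeLinearEquiv_apply_coe A.grading n ⟨x, hx⟩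
  simp only [bar, LinearMap.comp_apply, LinearEquiv.coe_coe, h, DirectSum.toModule_lof,
    LinearMap.smul_apply, Submodule.subtype_apply, smul_eq_mul]

/-- The inverse `ζ⁻¹ = ζ ∘ S` of the character under convolution. -/
def charInv : H →ₗ[ℂ] ℂ := A.char.toLinearMap ∘ₗ HopfAlgebra.antipode ℂ

/-- The odd Hopf subalgebra `S₋(H, ζ)`: the largest subcoalgebra contained in the kernel of
`bar (ζ⁻¹) - ζ`. -/
def oddPart : Submodule ℂ H :=
  largestSubcoalgebra (LinearMap.ker (A.bar A.charInv - A.char.toLinearMap))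

/-- The even Hopf subalgebra `S₊(H, ζ)`: the largest subcoalgebra contained in the kernel of
`bar ζ - ζ`. -/
def evenPart : Submodule ℂ H :=
  largestSubcoalgebra (LinearMap.ker (A.bar A.char.toLinearMap - A.char.toLinearMap))

end CombinatorialHopfAlgebra

section Words

variable {I : Type*}

/-- The degree of a word in letters of given degrees. -/
def wordDegree (deg : I → ℕ+) (w : List I) : ℕ := (w.map fun i => (deg i : ℕ)).sum

/-- A word is odd if all its letters have odd degree. -/
def OddWord (deg : I → ℕ+) (w : List I) : Prop := ∀ i ∈ w, Odd (deg i : ℕ)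

/-- A word is even if all its letters have even degree. -/
def EvenWord (deg : I → ℕ+) (w : List I) : Prop := ∀ i ∈ w, Even (deg i : ℕ)

/-- The span of the elements `e w` for the words `w` with a property `P`. For `P` one of `OddWord`,
`EvenWord` and `e` the family of words in the shuffle, tensor or symmetric algebra of `V`, this is
the Hopf subalgebra of odd, respectively even, elements, i.e. the shuffle, tensor or symmetric
algebra of the span `O(V)` or `E(V)` of the basis vectors of odd or even degree. -/
def wordSpan {H : Type*} [AddCommGroup H] [Module ℂ H] (e : List I → H) (P : List I → Prop) :
    Submodule ℂ H :=
  Submodule.span ℂ (e '' {w | P w})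

/-- The span of the elements `e w` for the words `w` of degree `n`. -/
def wordGrading {H : Type*} [AddCommGroup H] [Module ℂ H] (e : List I → H) (deg : I → ℕ+)
    (n : ℕ) : Submodule ℂ H :=
  wordSpan e fun w => wordDegree deg w = n

variable {H : Type*} [AddCommGroup H] [Module ℂ H] {e : List I → H} {deg : I → ℕ+}

theorem mem_wordGrading (w : List I) : e w ∈ wordGrading e deg (wordDegree deg w) :=
  Submodule.subset_span ⟨w, rfl, rfl⟩

theorem wordGrading_le {n : ℕ} {K : Submodule ℂ H} (h : ∀ w, wordDegree deg w = n → e w ∈ K) :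
    wordGrading e deg n ≤ K :=
  Submodule.span_le.mpr (by rintro _ ⟨w, hw, rfl⟩; exact h w hw)

@[simp] theorem wordDegree_nil : wordDegree deg [] = 0 := rfl

@[simp] theorem wordDegree_cons (i : I) (w : List I) :
    wordDegree deg (i :: w) = deg i + wordDegree deg w := rfl

@[simp] theorem wordDegree_append (u v : List I) :
    wordDegree deg (u ++ v) = wordDegree deg u + wordDegree deg v := by
  simp [wordDegree]

theorem wordDegree_perm {u v : List I} (h : u.Perm v) : wordDegree deg u = wordDegree deg v :=
  (h.map _).sum_eq

theorem wordDegree_eq_zero {w : List I} : wordDegree deg w = 0 ↔ w = [] := by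
  cases w with
  | nil => simp
  | cons i w => simp

theorem wordGrading_zero : wordGrading e deg 0 = Submodule.span ℂ {e []} := by
  simp [wordGrading, wordSpan, wordDegree_eq_zero]

theorem tmul_mem_iSup {u v : H} {m n k : ℕ} (hu : u ∈ wordGrading e deg m)
    (hv : v ∈ wordGrading e deg n) (h : m + n = k) :
    u ⊗ₜ[ℂ] v ∈ tensorGrading (wordGrading e deg) k := by
  refine Submodule.mem_iSup_of_mem (m, n) (Submodule.mem_iSup_of_mem h ?_)
  exact ⟨⟨u, hu⟩ ⊗ₜ ⟨v, hv⟩, rfl⟩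

end Words

namespace ShuffleAlgebra

variable {I : Type*} (deg : I → ℕ+)

instance : SetLike.GradedMonoid (wordGrading (word (I := I)) deg) where
  one_mem := mem_wordGrading (deg := deg) (e := word) []
  mul_mem m n x y hx hy := by
    have h : wordGrading word deg m * wordGrading word deg n ≤ wordGrading word deg (m + n) := by
      rw [wordGrading, wordGrading, wordSpan, wordSpan, Submodule.span_mul_span,
        Submodule.span_le]
      rintro _ ⟨_, ⟨u, hu, rfl⟩, _, ⟨v, hv, rfl⟩, rfl⟩
      simp only [Set.mem_ofPred_eq] at hu hv
      simp only [SetLike.mem_coe, word_mul_word]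
      refine multiset_sum_mem _ fun z hz => ?_
      obtain ⟨w, hw, rfl⟩ := Multiset.mem_map.mp hz
      have := wordDegree_perm (deg := deg) (perm_of_mem_shuffles hw)
      rw [wordDegree_append, hu, hv] at this
      exact this ▸ mem_wordGrading w
    exact h (Submodule.mul_mem_mul hx hy)

instance : GradedAlgebra (wordGrading (word (I := I)) deg) :=
  { (inferInstance : SetLike.GradedMonoid (wordGrading (word (I := I)) deg)),
    DirectSum.Decomposition.ofLinearMap (wordGrading (word (I := I)) deg)
      (extend fun w => DirectSum.lof ℂ ℕ (fun n => wordGrading (word (I := I)) deg n)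
        (wordDegree deg w) ⟨word w, mem_wordGrading w⟩)
      (hom_ext fun w => by simp)
      (by
        refine DirectSum.linearMap_ext _ fun n => LinearMap.ext fun ⟨x, hx⟩ => ?_
        simp only [LinearMap.comp_apply, DirectSum.coeLinearMap_lof, LinearMap.id_apply]
        induction hx using Submodule.span_induction with
        | mem x hx =>
          obtain ⟨w, hw, rfl⟩ := hx
          obtain rfl : _ = n := hw
          rw [extend_word]
        | zero => rw [map_zero]; exact (map_zero _).symm
        | add x y hx hy ihx ihy => rw [map_add, ihx, ihy, ← map_add]; rfl
        | smul r x hx ih => rw [map_smul, ih, ← map_smul]; rfl) with }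

/-- The shuffle algebra as a combinatorial Hopf algebra with its canonical character. -/
def combinatorialHopfAlgebra : CombinatorialHopfAlgebra (ShuffleAlgebra I) where
  grading := wordGrading word deg
  comul_mem n := by
    refine wordGrading_le (K := Submodule.comap (Coalgebra.comul (R := ℂ))
      (tensorGrading (wordGrading word deg) n)) fun w hw => ?_
    rw [Submodule.mem_comap, comul_eq, deconcat, extend_word]
    refine Submodule.sum_mem _ fun i _ => ?_
    refine tmul_mem_iSup (mem_wordGrading _) (mem_wordGrading _) ?_
    rw [← wordDegree_append, List.take_append_drop, hw]
  counit_eq_zero n hn := by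
    refine wordGrading_le (K := LinearMap.ker (Coalgebra.counit (R := ℂ))) fun w hw => ?_
    rw [LinearMap.mem_ker, counit_eq, coeffNil, extend_word, if_neg]
    rw [List.isEmpty_iff, ← wordDegree_eq_zero (deg := deg), hw]
    exact hn
  antipode_mem n := by
    refine wordGrading_le (K := Submodule.comap (HopfAlgebra.antipode ℂ)
      (wordGrading word deg n)) fun w hw => ?_
    rw [Submodule.mem_comap, antipode_word]
    refine Submodule.smul_mem _ _ ?_
    rw [← hw, ← wordDegree_perm w.reverse_perm]
    exact mem_wordGrading _
  connected := wordGrading_zero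
  char := canonicalChar deg

end ShuffleAlgebra

section Primitive

variable {I : Type*} {H : Type*} [Ring H] {g : I → H} {deg : I → ℕ+}

/-- The product of the generators along a word. -/
def wordProd (g : I → H) (w : List I) : H := (w.map g).prod

theorem wordProd_append (u v : List I) : wordProd g (u ++ v) = wordProd g u * wordProd g v := by
  simp [wordProd]

theorem wordProd_cons (i : I) (w : List I) : wordProd g (i :: w) = g i * wordProd g w := by
  simp [wordProd]

variable [HopfAlgebra ℂ H]

theorem mem_wordGrading_gen (i : I) : g i ∈ wordGrading (wordProd g) deg (deg i) := by
  have := mem_wordGrading (e := wordProd g) (deg := deg) [i]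
  simpa [wordProd] using this

instance wordProd_gradedMonoid (g : I → H) (deg : I → ℕ+) :
    SetLike.GradedMonoid (wordGrading (wordProd g) deg) where
  one_mem := mem_wordGrading (deg := deg) (e := wordProd g) []
  mul_mem m n x y hx hy := by
    have h : wordGrading (wordProd g) deg m * wordGrading (wordProd g) deg n ≤
        wordGrading (wordProd g) deg (m + n) := by
      rw [wordGrading, wordGrading, wordSpan, wordSpan, Submodule.span_mul_span,
        Submodule.span_le]
      rintro _ ⟨_, ⟨u, hu, rfl⟩, _, ⟨v, hv, rfl⟩, rfl⟩
      simp only [Set.mem_ofPred_eq] at hu hv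
      have := mem_wordGrading (e := wordProd g) (deg := deg) (u ++ v)
      rw [wordDegree_append, hu, hv, wordProd_append] at this
      exact this
    exact h (Submodule.mul_mem_mul hx hy)

theorem wordProd_decompose (f : H →ₐ[ℂ] DirectSum ℕ fun n => wordGrading (wordProd g) deg n)
    (hf : ∀ i, f (g i) = DirectSum.of (fun n => wordGrading (wordProd g) deg n) (deg i)
      ⟨g i, mem_wordGrading_gen i⟩) (n : ℕ) (x : wordGrading (wordProd g) deg n) :
    f (x : H) = DirectSum.of (fun n => wordGrading (wordProd g) deg n) n x := by
  have hw : ∀ w : List I, f (wordProd g w) = DirectSum.of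
      (fun n => wordGrading (wordProd g) deg n) (wordDegree deg w)
      ⟨wordProd g w, mem_wordGrading w⟩ := by
    intro w
    induction w with
    | nil => exact map_one f
    | cons i w ih =>
      have h : f (wordProd g (i :: w)) = f (g i) * f (wordProd g w) := by
        rw [wordProd_cons, map_mul]
      rw [h, ih, hf, DirectSum.of_mul_of]
      exact DirectSum.of_eq_of_gradedMonoid_eq
        (Sigma.subtype_ext rfl (wordProd_cons i w).symm)
  obtain ⟨x, hx⟩ := x
  induction hx using Submodule.span_induction with
  | mem x hx =>
    obtain ⟨w, hw', rfl⟩ := hx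
    obtain rfl : _ = n := hw'
    exact hw w
  | zero => simp only [map_zero]; exact (map_zero _).symm
  | add x y hx hy ihx ihy => simp only [map_add, ihx, ihy]; rw [← map_add]; rfl
  | smul r x hx ih =>
    simp only [map_smul, ih]
    exact (DirectSum.lof ℂ ℕ (fun n => wordGrading (wordProd g) deg n) n).map_smul r _ |>.symm

theorem wordProd_comul_mem
    (hg : ∀ i, Coalgebra.comul (R := ℂ) (g i) = g i ⊗ₜ[ℂ] 1 + 1 ⊗ₜ[ℂ] g i) (n : ℕ) (x : H)
    (hx : x ∈ wordGrading (wordProd g) deg n) :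
    Coalgebra.comul (R := ℂ) x ∈ tensorGrading (wordGrading (wordProd g) deg) n := by
  refine wordGrading_le (K := Submodule.comap (Coalgebra.comul (R := ℂ))
    (tensorGrading (wordGrading (wordProd g) deg) n)) (fun w hw => ?_) hx
  subst hw
  rw [Submodule.mem_comap]
  clear hx
  induction w with
  | nil =>
    simp only [wordProd, List.map_nil, List.prod_nil, Bialgebra.comul_one,
      Algebra.TensorProduct.one_def]
    have h := mem_wordGrading (e := wordProd g) (deg := deg) []
    exact tmul_mem_iSup h h rfl
  | cons i w ih =>
    rw [wordProd_cons, Bialgebra.comul_mul, hg]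
    suffices h : tensorGrading (wordGrading (wordProd g) deg) (wordDegree deg w) ≤
        Submodule.comap (LinearMap.mulLeft ℂ (g i ⊗ₜ[ℂ] 1 + 1 ⊗ₜ[ℂ] g i))
          (tensorGrading (wordGrading (wordProd g) deg) (wordDegree deg (i :: w))) from h ih
    refine iSup₂_le fun p hp => ?_
    rintro _ ⟨t, rfl⟩
    induction t with
    | zero => simp
    | add s t hs ht => rw [map_add]; exact Submodule.add_mem _ hs ht
    | tmul a b =>
      rw [Submodule.mem_comap, LinearMap.mulLeft_apply, TensorProduct.map_tmul, add_mul,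
        Algebra.TensorProduct.tmul_mul_tmul, Algebra.TensorProduct.tmul_mul_tmul, one_mul, one_mul]
      have hi := mem_wordGrading_gen (g := g) (deg := deg) i
      refine Submodule.add_mem _ ?_ ?_
      · exact tmul_mem_iSup (SetLike.mul_mem_graded hi a.2) b.2 (by
          rw [wordDegree_cons]; omega)
      · exact tmul_mem_iSup a.2 (SetLike.mul_mem_graded hi b.2) (by
          rw [wordDegree_cons]; omega)

theorem wordProd_counit_eq_zero (hg : ∀ i, Coalgebra.counit (R := ℂ) (g i) = 0) (n : ℕ)
    (hn : n ≠ 0) (x : H) (hx : x ∈ wordGrading (wordProd g) deg n) :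
    Coalgebra.counit (R := ℂ) x = 0 := by
  refine wordGrading_le (K := LinearMap.ker (Coalgebra.counit (R := ℂ))) (fun w hw => ?_) hx
  cases w with
  | nil => exact absurd hw hn.symm
  | cons i w => rw [LinearMap.mem_ker, wordProd_cons, Bialgebra.counit_mul, hg, zero_mul]

theorem wordProd_antipode_mem (hg : ∀ i, HopfAlgebra.antipode ℂ (g i) = -g i) (n : ℕ) (x : H)
    (hx : x ∈ wordGrading (wordProd g) deg n) :
    HopfAlgebra.antipode ℂ x ∈ wordGrading (wordProd g) deg n := by
  refine wordGrading_le (K := Submodule.comap (HopfAlgebra.antipode ℂ)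
    (wordGrading (wordProd g) deg n)) (fun w hw => ?_) hx
  subst hw
  rw [Submodule.mem_comap]
  clear hx
  induction w with
  | nil =>
    simp only [wordProd, List.map_nil, List.prod_nil, HopfAlgebra.antipode_one]
    exact mem_wordGrading (e := wordProd g) (deg := deg) []
  | cons i w ih =>
    rw [wordProd_cons, HopfAlgebra.antipode_mul_antidistrib, hg, wordDegree_cons, add_comm]
    exact SetLike.mul_mem_graded ih (Submodule.neg_mem _ (mem_wordGrading_gen i))

end Primitive

namespace TensorAlgebra

variable {I V : Type*} [AddCommGroup V] [Module ℂ V] (b : Module.Basis I ℂ V) (deg : I → ℕ+)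

/-- The word `v_α = v_{α₁} ⋯ v_{α_ℓ}` in the tensor algebra. -/
abbrev word : List I → TensorAlgebra ℂ V := wordProd fun i => ι ℂ (b i)

/-- The canonical character of the tensor algebra: the composite of the algebra map
`v_i ↦ p_{deg v_i}` with `f ↦ f (1, 0, 0, …)`. -/
def canonicalChar : TensorAlgebra ℂ V →ₐ[ℂ] ℂ :=
  QuasiSymmetric.zeta.comp (lift ℂ (b.constr ℂ fun i => QuasiSymmetric.powerSum (deg i)))

instance wordGradedAlgebra : GradedAlgebra (wordGrading (word b) deg) :=
  haveI : SetLike.GradedMonoid (wordGrading (word b) deg) := wordProd_gradedMonoid _ deg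
  GradedAlgebra.ofAlgHom _
    (lift ℂ (b.constr ℂ fun i => DirectSum.of (fun n => wordGrading (word b) deg n) (deg i)
      ⟨ι ℂ (b i), mem_wordGrading_gen i⟩))
    (by
      apply TensorAlgebra.hom_ext
      refine b.ext fun i => ?_
      simp [DirectSum.coeAlgHom_of])
    (wordProd_decompose _ fun i => by simp)

/-- The tensor algebra as a combinatorial Hopf algebra with its canonical character. -/
def combinatorialHopfAlgebra : CombinatorialHopfAlgebra (TensorAlgebra ℂ V) where
  grading := wordGrading (word b) deg
  comul_mem := wordProd_comul_mem fun i => comul_ι (b i)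
  counit_eq_zero := wordProd_counit_eq_zero fun i => counit_ι (b i)
  antipode_mem := wordProd_antipode_mem fun i => negReverse_ι (b i)
  connected := wordGrading_zero
  char := canonicalChar b deg

end TensorAlgebra

namespace SymmetricAlgebra

variable {I V : Type*} [AddCommGroup V] [Module ℂ V] (b : Module.Basis I ℂ V) (deg : I → ℕ+)

/-- The class of the word `v_α` in the symmetric algebra. -/
abbrev word : List I → SymmetricAlgebra ℂ V := wordProd fun i => ι ℂ V (b i)

/-- The canonical character of the symmetric algebra: the composite of the algebra map
`v_i ↦ p_{deg v_i}` with `f ↦ f (1, 0, 0, …)`. -/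
def canonicalChar : SymmetricAlgebra ℂ V →ₐ[ℂ] ℂ :=
  QuasiSymmetric.zeta.comp (lift (b.constr ℂ fun i => QuasiSymmetric.powerSum (deg i)))

instance wordGradedAlgebra : GradedAlgebra (wordGrading (word b) deg) :=
  haveI : SetLike.GradedMonoid (wordGrading (word b) deg) := wordProd_gradedMonoid _ deg
  GradedAlgebra.ofAlgHom _
    (lift (b.constr ℂ fun i => DirectSum.of (fun n => wordGrading (word b) deg n) (deg i)
      ⟨ι ℂ V (b i), mem_wordGrading_gen i⟩))
    (by
      apply SymmetricAlgebra.algHom_ext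
      refine b.ext fun i => ?_
      simp [DirectSum.coeAlgHom_of])
    (wordProd_decompose _ fun i => by simp)

/-- The symmetric algebra as a combinatorial Hopf algebra with its canonical character. -/
def combinatorialHopfAlgebra : CombinatorialHopfAlgebra (SymmetricAlgebra ℂ V) where
  grading := wordGrading (word b) deg
  comul_mem := wordProd_comul_mem fun i => comul_ι ℂ V (b i)
  counit_eq_zero := wordProd_counit_eq_zero fun i => counit_ι ℂ V (b i)
  antipode_mem := wordProd_antipode_mem fun i => lift_ι_apply _ (b i)
  connected := wordGrading_zero
  char := canonicalChar b deg

end SymmetricAlgebra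

namespace ShuffleAlgebra

variable {I V : Type*} [AddCommGroup V] [Module ℂ V]

/-- The underlying vector space of the shuffle algebra is `⨁ n, V^{⊗ n}`, for any vector space `V`
with a basis `b` indexed by the alphabet; a word `α` of length `ℓ` corresponds to the tensor
`b α₁ ⊗ ⋯ ⊗ b α_ℓ`. -/
def equivDirectSum (b : Module.Basis I ℂ V) :
    ShuffleAlgebra I ≃ₗ[ℂ] DirectSum ℕ fun n => ⨂[ℂ]^n V :=
  ((wordBasis I).equiv b.tensorAlgebra FreeMonoid.ofList).trans
    TensorAlgebra.equivDirectSum.toLinearEquiv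

theorem equivDirectSum_word (b : Module.Basis I ℂ V) (w : List I) :
    equivDirectSum b (word w) = DirectSum.of (fun n => ⨂[ℂ]^n V) w.length
      (PiTensorProduct.tprod ℂ fun k => b (w.get k)) := by
  have h1 : (wordBasis I).equiv b.tensorAlgebra FreeMonoid.ofList (word w) =
      TensorAlgebra.word b w := by
    have h : b.tensorAlgebra (FreeMonoid.ofList w) =
        (TensorAlgebra.equivFreeAlgebra b).symm
          (FreeAlgebra.equivMonoidAlgebraFreeMonoid.symm
            (MonoidAlgebra.single (FreeMonoid.ofList w) 1)) := rfl
    rw [word, Module.Basis.equiv_apply, h]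
    induction w with
    | nil =>
      change _ = (1 : TensorAlgebra ℂ V)
      rw [show MonoidAlgebra.single (FreeMonoid.ofList ([] : List I)) (1 : ℂ) = 1 from rfl,
        map_one, map_one]
    | cons i w ih =>
      have e : MonoidAlgebra.single (FreeMonoid.ofList (i :: w)) (1 : ℂ) =
          MonoidAlgebra.single (FreeMonoid.of i) 1 * MonoidAlgebra.single (FreeMonoid.ofList w) 1 := by
        rw [MonoidAlgebra.single_mul_single, one_mul]; rfl
      have h' := ih rfl
      rw [e, map_mul, map_mul, h', TensorAlgebra.word, wordProd_cons]
      congr 1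
      simp [FreeAlgebra.equivMonoidAlgebraFreeMonoid]
  have h2 : TensorAlgebra.ofDirectSum (DirectSum.of (fun n => ⨂[ℂ]^n V) w.length
      (PiTensorProduct.tprod ℂ fun k => b (w.get k))) = TensorAlgebra.word b w := by
    rw [TensorAlgebra.ofDirectSum_of_tprod, TensorAlgebra.tprod_apply]
    simp only [TensorAlgebra.word, wordProd]
    congr 1
    conv_rhs => rw [← List.ofFn_get w, List.map_ofFn]
    rfl
  exact (congrArg TensorAlgebra.toDirectSum (h1.trans h2.symm)).trans
    (TensorAlgebra.toDirectSum_ofDirectSum _)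

end ShuffleAlgebra

section
variable {I V : Type*} [AddCommGroup V] [Module ℂ V]

theorem adjoin_eq_wordSpan {H : Type*} [Ring H] [Algebra ℂ H] (f : V →ₗ[ℂ] H)
    (b : Module.Basis I ℂ V) (P : I → Prop) :
    Subalgebra.toSubmodule (Algebra.adjoin ℂ
      (f '' (Submodule.span ℂ (b '' {i | P i}) : Set V))) =
      wordSpan (wordProd fun i => f (b i)) fun w => ∀ i ∈ w, P i := by
  apply le_antisymm
  · intro x hx
    rw [Subalgebra.mem_toSubmodule] at hx
    have hone : wordProd (fun i => f (b i)) [] ∈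
        wordSpan (wordProd fun i => f (b i)) fun w => ∀ i ∈ w, P i :=
      Submodule.subset_span ⟨[], by simp, rfl⟩
    induction hx using Algebra.adjoin_induction with
    | mem x hx =>
      obtain ⟨v, hv, rfl⟩ := hx
      have : Submodule.span ℂ (b '' {i | P i}) ≤ Submodule.comap f
          (wordSpan (wordProd fun i => f (b i)) fun w => ∀ i ∈ w, P i) := by
        rw [Submodule.span_le]
        rintro _ ⟨i, hi, rfl⟩
        exact Submodule.subset_span ⟨[i], by simpa using hi, by simp [wordProd]⟩
      exact this hv
    | algebraMap r => rw [Algebra.algebraMap_eq_smul_one]; exact Submodule.smul_mem _ r hone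
    | add x y _ _ hx hy => exact Submodule.add_mem _ hx hy
    | mul x y _ _ hx hy =>
      have h := Submodule.mul_mem_mul hx hy
      rw [wordSpan, Submodule.span_mul_span] at h
      refine Submodule.span_mono ?_ h
      rintro _ ⟨_, ⟨u, hu, rfl⟩, _, ⟨v, hv, rfl⟩, rfl⟩
      refine ⟨u ++ v, fun i hi => ?_, wordProd_append u v⟩
      rcases List.mem_append.mp hi with h | h
      exacts [hu i h, hv i h]
  · rw [wordSpan, Submodule.span_le]
    rintro _ ⟨w, hw, rfl⟩
    refine Subalgebra.list_prod_mem _ fun x hx => ?_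
    obtain ⟨i, hi, rfl⟩ := List.mem_map.mp hx
    exact Algebra.subset_adjoin ⟨b i, Submodule.subset_span ⟨i, hw i hi, rfl⟩, rfl⟩

end

namespace TensorAlgebra
variable {I V : Type*} [AddCommGroup V] [Module ℂ V]

/-- The image of the tensor algebra of the subspace of `V` spanned by the basis vectors with a
property `P` is spanned by the words in these basis vectors. -/
theorem range_lift_eq_wordSpan (b : Module.Basis I ℂ V) (P : I → Prop) :
    Subalgebra.toSubmodule
      (lift ℂ (ι ℂ ∘ₗ (Submodule.span ℂ (b '' {i | P i})).subtype)).range =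
      wordSpan (word b) fun w => ∀ i ∈ w, P i := by
  rw [← adjoin_eq_wordSpan, range_lift, LinearMap.coe_comp, Set.range_comp]
  simp

end TensorAlgebra

namespace SymmetricAlgebra
variable {I V : Type*} [AddCommGroup V] [Module ℂ V]

/-- The image of the symmetric algebra of the subspace of `V` spanned by the basis vectors with a
property `P` is spanned by the words in these basis vectors. -/
theorem range_lift_eq_wordSpan (b : Module.Basis I ℂ V) (P : I → Prop) :
    Subalgebra.toSubmodule
      (lift (ι ℂ V ∘ₗ (Submodule.span ℂ (b '' {i | P i})).subtype)).range =
      wordSpan (word b) fun w => ∀ i ∈ w, P i := by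
  rw [← adjoin_eq_wordSpan]
  congr 1
  apply le_antisymm
  · rintro _ ⟨x, rfl⟩
    induction x using SymmetricAlgebra.induction with
    | algebraMap r => simp
    | ι v => exact Algebra.subset_adjoin ⟨v, v.2, by simp⟩
    | mul x y hx hy => simpa using mul_mem hx hy
    | add x y hx hy => simpa using add_mem hx hy
  · refine Algebra.adjoin_le ?_
    rintro _ ⟨v, hv, rfl⟩
    exact ⟨ι ℂ _ ⟨v, hv⟩, by simp⟩

end SymmetricAlgebra

end

/-! ### Signs attached to degrees, and subcoalgebras spanned by words. -/

section

variable {I H : Type*} {deg : I → ℕ+}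

/-! Each of `oddPart` and `evenPart` is the greatest subcoalgebra inside the kernel of a linear
functional. A span of words therefore lies in it as soon as the span is a subcoalgebra and the
functional vanishes on each spanning word.

The first condition has nothing to do with parity: it holds for the words whose letters all satisfy
any fixed property. Deconcatenation cuts a word into a prefix and a suffix, which use only letters
of the word (`ShuffleAlgebra.isSubcoalgebra_wordSpan_word`). When the letters are primitive, the
coproduct of a product of letters is built from products of those same letters
(`isSubcoalgebra_wordSpan_wordProd`).

On even words the second condition is immediate for every functional: the degree is even, so the bar
does nothing. On odd words two signs meet. The bar contributes `(-1) ^ deg`, which equals `(-1) ^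
length` because each letter has odd degree. The antipode reverses the word and negates every letter,
which contributes another `(-1) ^ length`. The signs cancel, and what remains is that the character
must not see the reversal.

For the tensor and symmetric algebras this holds because the character is multiplicative with values
in the commutative ring `ℂ` (`CombinatorialHopfAlgebra.charInv_wordProd`). For the shuffle algebra
it holds because the character of an odd word of length `ℓ` is `1 / ℓ!`, which depends on the length
only (`ShuffleAlgebra.charInv_word_of_oddWord`). -/

theorem even_wordDegree_of_evenWord {w : List I} (h : EvenWord deg w) :
    Even (wordDegree deg w) := by
  induction w with
  | nil => simp
  | cons i w ih =>
    rw [wordDegree_cons]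
    exact (h i (by simp)).add (ih fun j hj => h j (List.mem_cons_of_mem _ hj))

/-- Every letter of odd degree contributes exactly one factor `-1`. This turns the sign of the bar,
which is governed by the degree, into the sign of the antipode, which is governed by the length. -/
theorem neg_one_pow_wordDegree_of_oddWord {w : List I} (h : OddWord deg w) :
    (-1 : ℂ) ^ wordDegree deg w = (-1) ^ w.length := by
  induction w with
  | nil => simp
  | cons i w ih =>
    rw [wordDegree_cons, pow_add, (h i (by simp)).neg_one_pow,
      ih fun j hj => h j (List.mem_cons_of_mem _ hj), List.length_cons, pow_succ']

theorem tmul_mem_range_map_subtype [AddCommGroup H] [Module ℂ H] {C : Submodule ℂ H} {x y : H}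
    (hx : x ∈ C) (hy : y ∈ C) :
    x ⊗ₜ[ℂ] y ∈ LinearMap.range (TensorProduct.map C.subtype C.subtype) :=
  ⟨⟨x, hx⟩ ⊗ₜ ⟨y, hy⟩, rfl⟩

/-- The coproduct is linear and the image of `C ⊗ C` is a subspace, so the subcoalgebra condition
need only be tested on a spanning family. -/
theorem isSubcoalgebra_wordSpan [AddCommGroup H] [Module ℂ H] [Coalgebra ℂ H] {e : List I → H}
    {P : List I → Prop}
    (h : ∀ w, P w → Coalgebra.comul (R := ℂ) (e w) ∈ LinearMap.range
      (TensorProduct.map (wordSpan e P).subtype (wordSpan e P).subtype)) :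
    IsSubcoalgebra (wordSpan e P) := by
  suffices hle : wordSpan e P ≤ Submodule.comap (Coalgebra.comul (R := ℂ)) (LinearMap.range
      (TensorProduct.map (wordSpan e P).subtype (wordSpan e P).subtype)) from fun x hx => hle hx
  refine Submodule.span_le.mpr ?_
  rintro _ ⟨w, hw, rfl⟩
  exact h w hw

/-- The words in primitive generators with a property span a subcoalgebra. -/
theorem isSubcoalgebra_wordSpan_wordProd [Ring H] [HopfAlgebra ℂ H] {g : I → H}
    (hg : ∀ i, Coalgebra.comul (R := ℂ) (g i) = g i ⊗ₜ[ℂ] 1 + 1 ⊗ₜ[ℂ] g i) (P : I → Prop) :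
    IsSubcoalgebra (wordSpan (wordProd g) fun w => ∀ i ∈ w, P i) := by
  refine isSubcoalgebra_wordSpan fun w hw => ?_
  set C : Submodule ℂ H := wordSpan (wordProd g) fun w => ∀ i ∈ w, P i with hC
  have hone : (1 : H) ∈ C := Submodule.subset_span ⟨[], by simp, by simp [wordProd]⟩
  -- The induction on words only ever multiplies on the left by one admissible generator, so this
  -- closure property suffices; closure of `C` under all products is not required.
  have hmul : ∀ i, P i → ∀ x ∈ C, g i * x ∈ C := by
    intro i hi x hx
    have hle : C ≤ Submodule.comap (LinearMap.mulLeft ℂ (g i)) C := by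
      refine Submodule.span_le.mpr ?_
      rintro _ ⟨u, hu, rfl⟩
      refine Submodule.subset_span ⟨i :: u, ?_, wordProd_cons i u⟩
      exact List.forall_mem_cons.mpr ⟨hi, hu⟩
    exact hle hx
  induction w with
  | nil =>
    simp only [wordProd, List.map_nil, List.prod_nil, Bialgebra.comul_one,
      Algebra.TensorProduct.one_def]
    exact tmul_mem_range_map_subtype hone hone
  | cons i w ih =>
    obtain ⟨hi, hw⟩ := List.forall_mem_cons.mp hw
    -- Lifting the coproduct of the shorter word to some `t` in `C ⊗ C` ensures that the induction
    -- on `t` below meets only pure tensors with both factors in `C`.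
    obtain ⟨t, ht⟩ := ih hw
    rw [wordProd_cons, Bialgebra.comul_mul, hg, ← ht]
    clear ht
    induction t with
    | zero => simp
    | add s t hs ht => rw [map_add, mul_add]; exact Submodule.add_mem _ hs ht
    | tmul x y =>
      -- Multiplying `x ⊗ y` by `g i ⊗ 1 + 1 ⊗ g i` gives `g i * x ⊗ y + x ⊗ g i * y`, and `hmul`
      -- keeps each altered factor in `C`.
      rw [TensorProduct.map_tmul, add_mul, Algebra.TensorProduct.tmul_mul_tmul,
        Algebra.TensorProduct.tmul_mul_tmul, one_mul, one_mul]
      exact Submodule.add_mem _ (tmul_mem_range_map_subtype (hmul i hi _ x.2) y.2)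
        (tmul_mem_range_map_subtype x.2 (hmul i hi _ y.2))

/-! ### Criteria for a span of words to lie in the even or odd part. -/

namespace CombinatorialHopfAlgebra

variable [Ring H] [HopfAlgebra ℂ H] (A : CombinatorialHopfAlgebra H) {e : List I → H}

/-- In even degrees the bar is the identity on functionals, so nothing about the particular
character enters. -/
theorem wordSpan_le_evenPart (he : ∀ w, e w ∈ A.grading (wordDegree deg w))
    (hsub : IsSubcoalgebra (wordSpan e (EvenWord deg))) :
    wordSpan e (EvenWord deg) ≤ A.evenPart := by
  refine (isGreatest_largestSubcoalgebra _).2 ⟨hsub, Submodule.span_le.mpr ?_⟩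
  rintro _ ⟨w, hw, rfl⟩
  rw [SetLike.mem_coe, LinearMap.mem_ker, LinearMap.sub_apply, A.bar_apply_of_mem _ (he w),
    (even_wordDegree_of_evenWord hw).neg_one_pow, one_mul, sub_self]

/-- The hypothesis `hinv` isolates the only fact about the character that differs between the Hopf
algebras. It supplies one factor `(-1) ^ length`, the bar supplies the other, and their product is
`1`. -/
theorem wordSpan_le_oddPart (he : ∀ w, e w ∈ A.grading (wordDegree deg w))
    (hsub : IsSubcoalgebra (wordSpan e (OddWord deg)))
    (hinv : ∀ w, OddWord deg w → A.charInv (e w) = (-1) ^ w.length * A.char (e w)) :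
    wordSpan e (OddWord deg) ≤ A.oddPart := by
  refine (isGreatest_largestSubcoalgebra _).2 ⟨hsub, Submodule.span_le.mpr ?_⟩
  rintro _ ⟨w, hw, rfl⟩
  rw [SetLike.mem_coe, LinearMap.mem_ker, LinearMap.sub_apply, A.bar_apply_of_mem _ (he w),
    neg_one_pow_wordDegree_of_oddWord hw, hinv w hw, ← mul_assoc, ← mul_pow, neg_one_mul, neg_neg,
    one_pow, one_mul, AlgHom.toLinearMap_apply, sub_self]

/-- The antipode is an antihomomorphism that negates each generator, and a character into `ℂ` does
not depend on the order of the factors. The identity thus holds for all words, odd or not; parity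
matters only when the length is compared with the degree. -/
theorem charInv_wordProd {g : I → H} (hg : ∀ i, HopfAlgebra.antipode ℂ (g i) = -g i)
    (w : List I) : A.charInv (wordProd g w) = (-1) ^ w.length * A.char (wordProd g w) := by
  simp only [charInv, LinearMap.comp_apply, AlgHom.toLinearMap_apply]
  induction w with
  | nil => simp [wordProd]
  | cons i w ih =>
    -- The image of the first letter comes out as the last factor; once everything is in `ℂ`, `ring`
    -- moves it back to the front.
    rw [wordProd_cons, HopfAlgebra.antipode_mul_antidistrib, hg, map_mul, map_mul, ih, map_neg,
      List.length_cons, pow_succ]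
    ring

end CombinatorialHopfAlgebra

end

/-! ### The shuffle algebra: deconcatenation and the character on odd words. -/

namespace ShuffleAlgebra

variable {I : Type*}

/-- A condition imposed letter by letter passes to prefixes and suffixes, and these are the tensor
factors produced by deconcatenation. -/
theorem isSubcoalgebra_wordSpan_word (P : I → Prop) :
    IsSubcoalgebra (wordSpan word fun w : List I => ∀ i ∈ w, P i) := by
  refine isSubcoalgebra_wordSpan fun w hw => ?_
  rw [comul_eq, deconcat, extend_word]
  refine Submodule.sum_mem _ fun n _ => tmul_mem_range_map_subtype ?_ ?_
  · exact Submodule.subset_span ⟨_, fun i hi => hw i (List.mem_of_mem_take hi), rfl⟩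
  · exact Submodule.subset_span ⟨_, fun i hi => hw i (List.mem_of_mem_drop hi), rfl⟩

/-- Evaluation at `(1, 0, 0, …)` kills every `M_β` with at least two parts, so only the coarsest
cutting can contribute. For an odd word it is always allowed, since there is no even part to follow
an odd one. -/
theorem canonicalChar_word_of_oddWord {deg : I → ℕ+} {w : List I} (hw : OddWord deg w) :
    canonicalChar deg (word w) = QuasiSymmetric.blockCoeff (w.map fun i => (deg i : ℕ)) := by
  classical
  have h : canonicalChar deg (word w) =
      QuasiSymmetric.zeta (QuasiSymmetric.shuffleFun (w.map fun i => (deg i : ℕ))) :=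
    congrArg QuasiSymmetric.zeta (extend_word _ w)
  rw [h, QuasiSymmetric.zeta_shuffleFun, if_pos]
  · exact noOddToEven_of_odd (by simpa [OddWord] using hw)
  · simp

/-- The reversal of an odd word is odd, and the character sees only the numbers of odd and even
parts. Oddness cannot simply be dropped: for an even letter followed by an odd one the character is
`1`, while on the reversed word it is `0`. -/
theorem charInv_word_of_oddWord {deg : I → ℕ+} {w : List I} (hw : OddWord deg w) :
    (combinatorialHopfAlgebra deg).charInv (word w) =
      (-1) ^ w.length * (combinatorialHopfAlgebra deg).char (word w) := by
  have hr : OddWord deg w.reverse := fun i hi => hw i (List.mem_reverse.mp hi)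
  rw [CombinatorialHopfAlgebra.charInv, LinearMap.comp_apply, antipode_word, map_smul,
    smul_eq_mul]
  congr 1
  change canonicalChar deg (word w.reverse) = canonicalChar deg (word w)
  rw [canonicalChar_word_of_oddWord hr, canonicalChar_word_of_oddWord hw]
  -- Both sides are built from counts of entries by parity, and reversing a list preserves such
  -- counts.
  simp [QuasiSymmetric.blockCoeff]

end ShuffleAlgebra

/-! ### The inclusions for the shuffle, tensor and symmetric algebras. -/

theorem mainTheorem9 {I V : Type*} [AddCommGroup V] [Module ℂ V] (b : Module.Basis I ℂ V)
    (deg : I → ℕ+) :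
    (wordSpan ShuffleAlgebra.word (OddWord deg) ≤
        (ShuffleAlgebra.combinatorialHopfAlgebra deg).oddPart ∧
      wordSpan ShuffleAlgebra.word (EvenWord deg) ≤
        (ShuffleAlgebra.combinatorialHopfAlgebra deg).evenPart) ∧
    (wordSpan (TensorAlgebra.word b) (OddWord deg) ≤
        (TensorAlgebra.combinatorialHopfAlgebra b deg).oddPart ∧
      wordSpan (TensorAlgebra.word b) (EvenWord deg) ≤
        (TensorAlgebra.combinatorialHopfAlgebra b deg).evenPart) ∧
    (wordSpan (SymmetricAlgebra.word b) (OddWord deg) ≤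
        (SymmetricAlgebra.combinatorialHopfAlgebra b deg).oddPart ∧
      wordSpan (SymmetricAlgebra.word b) (EvenWord deg) ≤
        (SymmetricAlgebra.combinatorialHopfAlgebra b deg).evenPart) := by
  refine ⟨⟨?_, ?_⟩, ⟨?_, ?_⟩, ?_, ?_⟩
  -- The grading is by definition spanned by the words of each degree, so `mem_wordGrading` gives
  -- homogeneity. `OddWord deg` unfolds to a condition on single letters, as the subcoalgebra lemma
  -- requires.
  · exact CombinatorialHopfAlgebra.wordSpan_le_oddPart _ mem_wordGrading
      (ShuffleAlgebra.isSubcoalgebra_wordSpan_word _)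
      fun _ => ShuffleAlgebra.charInv_word_of_oddWord
  · exact CombinatorialHopfAlgebra.wordSpan_le_evenPart _ mem_wordGrading
      (ShuffleAlgebra.isSubcoalgebra_wordSpan_word _)
  · exact CombinatorialHopfAlgebra.wordSpan_le_oddPart _ mem_wordGrading
      (isSubcoalgebra_wordSpan_wordProd (fun i => TensorAlgebra.comul_ι (b i)) _)
      fun w _ => CombinatorialHopfAlgebra.charInv_wordProd _
        -- The antipode of the tensor algebra is `negReverse` by definition, so this is the
        -- statement that it negates generators.
        (fun i => TensorAlgebra.negReverse_ι (b i)) w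
  · exact CombinatorialHopfAlgebra.wordSpan_le_evenPart _ mem_wordGrading
      (isSubcoalgebra_wordSpan_wordProd (fun i => TensorAlgebra.comul_ι (b i)) _)
  · exact CombinatorialHopfAlgebra.wordSpan_le_oddPart _ mem_wordGrading
      (isSubcoalgebra_wordSpan_wordProd (fun i => SymmetricAlgebra.comul_ι ℂ V (b i)) _)
      fun w _ => CombinatorialHopfAlgebra.charInv_wordProd _
        -- Here the antipode is by definition the algebra map extending `v ↦ -v`, so evaluating that
        -- lift on a generator gives the required negation.
        (fun i => SymmetricAlgebra.lift_ι_apply _ (b i)) w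
  · exact CombinatorialHopfAlgebra.wordSpan_le_evenPart _ mem_wordGrading
      (isSubcoalgebra_wordSpan_wordProd (fun i => SymmetricAlgebra.comul_ι ℂ V (b i)) _)
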